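/- Let $V\subseteq\mathbb R^n$ be open and consider on $V$ the chiral-type system $$\Delta^\alpha\equiv U^\alpha_{xy}+G^\alpha_{\beta\gamma}U^\beta_xU^\gamma_y+Q^\alpha=0\qquad(\alpha=1,\dots,n;\ \text{summation over repeated indices}),$$ where $G^\alpha_{\beta\gamma},Q^\alpha$ are smooth functions of $U=(U^1,\dots,U^n)\in V$. Suppose that the system has a Lax representation in a compact semisimple matrix Lie algebra $\mathfrak g$ (a real Lie algebra of matrices, semisimple, with negative definite Killing form $f$): there are $\mathfrak g$-valued functions $A_\alpha,B_\alpha,M,N$ (smooth) and $S_\alpha$ of $U\in V$ such that $\widetilde A=A_\alpha U^\alpha_x+M$, $\widetilde B=B_\alpha U^\alpha_y+N$ satisfy identically $$D_y\widetilde A-D_x\widetilde B+[\widetilde A,\widetilde B]=S_\alpha\Delta^\alpha .$$ Suppose moreover that 1) not all $Q^\alpha$ vanish identically on $V$; 2) $n\le\dim\mathfrak g\le n+1$; 3) at each point of $V$ the matrices $S_1,\dots,S_n$ are linearly independent. Then the system has at least one nontrivial conservation law with zeroth-order characteristic. More precisely, at least one of the two smooth covector fields $R_\alpha=f(S_\alpha,M)$,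 $R_\alpha=f(S_\alpha,N)$ on $V$ is not identically zero and has the following properties, where $\nabla_\alpha R_\beta=\partial R_\beta/\partial U^\alpha-G^\gamma_{\alpha\beta}R_\gamma$: - $\nabla_\alpha R_\beta+\nabla_\beta R_\alpha=0$; - $d\left(\nabla_\alpha R_\beta\,dU^\alpha\wedge dU^\beta\right)=0$; - $R_\alpha Q^\alpha=0$; - $R$ is the characteristic of a conservation law: over each open star-shaped $W\subseteq V$ (over $V$ itself, if $V$ is star-shaped) there are smooth functions $L_1,L_2$ of $x,y$, $U\in W$ and finitely many derivatives of $U$ with $D_xL_1+D_yL_2=R_\alpha\Delta^\alpha$ identically, and $(L_1,L_2)$ is nontrivial whenever $R$ is not identically zero on $W$. Here $(L_1,L_2)$ is called trivial if it is a sum of a pair of such functions that vanishes by virtue of the system and its differential consequences and a pair with identically zero divergence. -/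

import Mathlib

open scoped ContDiff

attribute [local instance 100] LieRing.ofAssociativeRing

noncomputable section

namespace ChiralType

/-- A point of the infinite jet space of maps `(x, y) ↦ (U¹, …, Uⁿ)`:
`u i j α` is the value of `∂ₓⁱ ∂ᵧʲ U^α`. -/
structure Jet (n : ℕ) where
  x : ℝ
  y : ℝ
  u : ℕ → ℕ → Fin n → ℝ

variable {n : ℕ}

/-- The total derivative `D_x F = ∂F/∂x + ∑ U^α_{i+1,j} ∂F/∂U^α_{i,j}`, written as the derivative
of `F` along the corresponding direction of the jet space. -/
def Dx {E : Type*} [NormedAddCommGroup E] [NormedSpace ℝ E] (F : Jet n → E) (p : Jet n) : E :=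
  deriv (fun t : ℝ => F ⟨p.x + t, p.y, fun i j α => p.u i j α + t * p.u (i + 1) j α⟩) 0

/-- The total derivative `D_y F = ∂F/∂y + ∑ U^α_{i,j+1} ∂F/∂U^α_{i,j}`. -/
def Dy {E : Type*} [NormedAddCommGroup E] [NormedSpace ℝ E] (F : Jet n → E) (p : Jet n) : E :=
  deriv (fun t : ℝ => F ⟨p.x, p.y + t, fun i j α => p.u i j α + t * p.u i (j + 1) α⟩) 0

/-- `D_x` of a matrix-valued function, entry by entry. -/
def matDx {m : ℕ} (F : Jet n → Matrix (Fin m) (Fin m) ℂ) (p : Jet n) :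
    Matrix (Fin m) (Fin m) ℂ :=
  Matrix.of fun i j => Dx (fun q => F q i j) p

/-- `D_y` of a matrix-valued function, entry by entry. -/
def matDy {m : ℕ} (F : Jet n → Matrix (Fin m) (Fin m) ℂ) (p : Jet n) :
    Matrix (Fin m) (Fin m) ℂ :=
  Matrix.of fun i j => Dy (fun q => F q i j) p

/-- The coordinates `x`, `y`, `U^α_{i,j}` with `i, j ≤ k` of a jet. -/
def Jet.trunc (k : ℕ) (p : Jet n) : ℝ × ℝ × (Fin (k + 1) → Fin (k + 1) → Fin n → ℝ) :=
  (p.x, p.y, fun i j => p.u i j)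

/-- `F` is a differential function over `W`: a smooth function of `x`, `y`, `U ∈ W` and
finitely many derivatives of `U`. -/
def IsDifferentialFunction (W : Set (Fin n → ℝ)) (F : Jet n → ℝ) : Prop :=
  ∃ (k : ℕ) (φ : ℝ × ℝ × (Fin (k + 1) → Fin (k + 1) → Fin n → ℝ) → ℝ),
    ContDiffOn ℝ ∞ φ {q | q.2.2 0 0 ∈ W} ∧
      ∀ p : Jet n, p.u 0 0 ∈ W → F p = φ (p.trunc k)

/-- The left-hand side of the chiral-type system,
`Δ^α = U^α_{xy} + G^α_{βγ} U^β_x U^γ_y + Q^α`. -/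
def chiralDelta (G : Fin n → Fin n → Fin n → (Fin n → ℝ) → ℝ) (Q : Fin n → (Fin n → ℝ) → ℝ)
    (α : Fin n) (p : Jet n) : ℝ :=
  p.u 1 1 α + (∑ β, ∑ γ, G α β γ (p.u 0 0) * p.u 1 0 β * p.u 0 1 γ) + Q α (p.u 0 0)

/-- The jet `p` satisfies the system together with all its differential consequences. -/
def OnEquation (G : Fin n → Fin n → Fin n → (Fin n → ℝ) → ℝ) (Q : Fin n → (Fin n → ℝ) → ℝ)
    (p : Jet n) : Prop :=
  ∀ (i j : ℕ) (α : Fin n), (Dx^[i] (Dy^[j] (chiralDelta G Q α))) p = 0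

/-- `(L₁, L₂)` is a conservation law over `W` of the system, with zeroth-order characteristic `R`:
`D_x L₁ + D_y L₂ = R_α Δ^α` identically on jets over `W`. -/
structure IsConservationLaw (W : Set (Fin n → ℝ))
    (G : Fin n → Fin n → Fin n → (Fin n → ℝ) → ℝ) (Q : Fin n → (Fin n → ℝ) → ℝ)
    (R : Fin n → (Fin n → ℝ) → ℝ) (L₁ L₂ : Jet n → ℝ) : Prop where
  smooth₁ : IsDifferentialFunction W L₁
  smooth₂ : IsDifferentialFunction W L₂
  div_eq : ∀ p : Jet n, p.u 0 0 ∈ W →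
    Dx L₁ p + Dy L₂ p = ∑ α, R α (p.u 0 0) * chiralDelta G Q α p

/-- `(L₁, L₂)` is trivial over `W`: it is the sum of a pair of differential functions which
vanishes by virtue of the system and its differential consequences, and of a pair whose
divergence vanishes identically. -/
def IsTrivialLaw (W : Set (Fin n → ℝ))
    (G : Fin n → Fin n → Fin n → (Fin n → ℝ) → ℝ) (Q : Fin n → (Fin n → ℝ) → ℝ)
    (L₁ L₂ : Jet n → ℝ) : Prop :=
  ∃ P₁ P₂ T₁ T₂ : Jet n → ℝ,
    IsDifferentialFunction W P₁ ∧ IsDifferentialFunction W P₂ ∧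
    IsDifferentialFunction W T₁ ∧ IsDifferentialFunction W T₂ ∧
    (∀ p : Jet n, p.u 0 0 ∈ W → L₁ p = P₁ p + T₁ p ∧ L₂ p = P₂ p + T₂ p) ∧
    (∀ p : Jet n, p.u 0 0 ∈ W → OnEquation G Q p → P₁ p = 0 ∧ P₂ p = 0) ∧
    (∀ p : Jet n, p.u 0 0 ∈ W → Dx T₁ p + Dy T₂ p = 0)

/-- The partial derivative `∂h/∂U^α`. -/
def pderiv (α : Fin n) (h : (Fin n → ℝ) → ℝ) (u : Fin n → ℝ) : ℝ :=
  fderiv ℝ h u (Pi.single α 1)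

/-- The covariant derivative `∇_α R_β = ∂R_β/∂U^α - G^γ_{αβ} R_γ`. -/
def covDeriv (G : Fin n → Fin n → Fin n → (Fin n → ℝ) → ℝ) (R : Fin n → (Fin n → ℝ) → ℝ)
    (α β : Fin n) (u : Fin n → ℝ) : ℝ :=
  pderiv α (R β) u - ∑ γ, G γ α β u * R γ u

/-- `∇_(α R_β) = 0` on `V`. -/
def IsKillingCovector (V : Set (Fin n → ℝ)) (G : Fin n → Fin n → Fin n → (Fin n → ℝ) → ℝ)
    (R : Fin n → (Fin n → ℝ) → ℝ) : Prop :=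
  ∀ u ∈ V, ∀ α β, covDeriv G R α β u + covDeriv G R β α u = 0

/-- The 2-form `w_{αβ} dU^α ∧ dU^β` is closed on `V`: with `a_{αβ} = w_{αβ} - w_{βα}` its
components, `∂_α a_{βγ} + ∂_β a_{γα} + ∂_γ a_{αβ} = 0`. -/
def IsClosedTwoForm (V : Set (Fin n → ℝ)) (w : Fin n → Fin n → (Fin n → ℝ) → ℝ) : Prop :=
  ∀ u ∈ V, ∀ α β γ,
    pderiv α (fun v => w β γ v - w γ β v) u + pderiv β (fun v => w γ α v - w α γ v) u +
      pderiv γ (fun v => w α β v - w β α v) u = 0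

/-- A compact semisimple real Lie algebra: semisimple with negative definite Killing form. -/
def IsCompactSemisimple (𝔤 : Type*) [LieRing 𝔤] [LieAlgebra ℝ 𝔤] : Prop :=
  LieAlgebra.IsSemisimple ℝ 𝔤 ∧ ∀ X : 𝔤, X ≠ 0 → killingForm ℝ 𝔤 X X < 0

/-- Smoothness on `V` of a function with values in a matrix Lie algebra, entry by entry. -/
def SmoothMat {m : ℕ} {𝔤 : LieSubalgebra ℝ (Matrix (Fin m) (Fin m) ℂ)} (V : Set (Fin n → ℝ))
    (X : (Fin n → ℝ) → 𝔤) : Prop :=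
  ∀ i j, ContDiffOn ℝ ∞ (fun u => (X u : Matrix (Fin m) (Fin m) ℂ) i j) V

/-- The Lax matrix `Ã = A_α U^α_x + M`. -/
def laxA {m : ℕ} {𝔤 : LieSubalgebra ℝ (Matrix (Fin m) (Fin m) ℂ)}
    (A : Fin n → (Fin n → ℝ) → 𝔤) (M : (Fin n → ℝ) → 𝔤) (p : Jet n) :
    Matrix (Fin m) (Fin m) ℂ :=
  ↑((∑ α, p.u 1 0 α • A α (p.u 0 0)) + M (p.u 0 0))

/-- The Lax matrix `B̃ = B_α U^α_y + N`. -/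
def laxB {m : ℕ} {𝔤 : LieSubalgebra ℝ (Matrix (Fin m) (Fin m) ℂ)}
    (B : Fin n → (Fin n → ℝ) → 𝔤) (N : (Fin n → ℝ) → 𝔤) (p : Jet n) :
    Matrix (Fin m) (Fin m) ℂ :=
  ↑((∑ α, p.u 0 1 α • B α (p.u 0 0)) + N (p.u 0 0))

/-- `Ã = A_α U^α_x + M`, `B̃ = B_α U^α_y + N` is a Lax representation over `V` of the system in the
matrix Lie algebra `𝔤`, with characteristic elements `S_α`:
`D_y Ã - D_x B̃ + [Ã, B̃] = S_α Δ^α` identically on jets over `V`. -/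
structure IsLaxRepresentation {m : ℕ} {𝔤 : LieSubalgebra ℝ (Matrix (Fin m) (Fin m) ℂ)}
    (V : Set (Fin n → ℝ))
    (G : Fin n → Fin n → Fin n → (Fin n → ℝ) → ℝ) (Q : Fin n → (Fin n → ℝ) → ℝ)
    (A B : Fin n → (Fin n → ℝ) → 𝔤) (M N : (Fin n → ℝ) → 𝔤)
    (S : Fin n → (Fin n → ℝ) → 𝔤) : Prop where
  smooth_A : ∀ α, SmoothMat V (A α)
  smooth_B : ∀ α, SmoothMat V (B α)
  smooth_M : SmoothMat V M
  smooth_N : SmoothMat V N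
  lax : ∀ p : Jet n, p.u 0 0 ∈ V →
    matDy (laxA A M) p - matDx (laxB B N) p + ⁅laxA A M p, laxB B N p⁆ =
      ↑(∑ α, chiralDelta G Q α p • S α (p.u 0 0))

end ChiralType

end

open ChiralType

open scoped ContDiff Topology Interval
open MeasureTheory Set

namespace ChiralType

/-! At each point of `V` the values of `U_x`, `U_y`, `U_xy` are free, so the Lax identity splits
into five: `S = A - B`, `[M, N] = Q^α S_α`, `∂_α N = [A_α, N]`, `∂_α M = [B_α, M]` and `∂_γ A_β -
∂_β B_γ + [A_β, B_γ] = G^α_{βγ} S_α`. Thus `N` is parallel for the connection `∂ - [A, ·]` and `M`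
for `∂ - [B, ·]`.

For `R = f(S, N)` the last identity eliminates `G`, and invariance of `f` gives `∇_α R_β = f(F_{αβ},
N)` with `F` the curvature of `A` (`covDeriv_pairing_right`). Skewness of `F` is the Killing
equation; the Bianchi identity together with parallelism of `N` gives closedness
(`curvature_pairing_closed`). For `R = f(S, M)` the curvature of `B` appears, plus the exact form
`dR` (`covDeriv_pairing_left`). Also `R_α Q^α = f([M, N], N)` or `f([M, N], M)`, which vanishes by
invariance.

One of the two covectors is nonzero at any point where `Q ≠ 0`: otherwise `M` and `N` both lie in
the Killing-orthogonal complement of the `S_α`, of dimension at most one, so they commute, and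
independence of the `S_α` forces `Q = 0` (`lie_eq_zero_of_orthogonal`).

Over a star-shaped set the Poincaré lemma yields `Ω` with `∂_α Ω_β - ∂_β Ω_α = ∇_α R_β`, and `L₁ =
(R_α - Ω_α) U^α_y`, `L₂ = Ω_α U^α_x` is the conservation law (`exists_isConservationLaw`).

Nontriviality (`not_isTrivialLaw`) compares fluxes through the noncharacteristic line `x + y = 0`.
For Cauchy data `U = u₀`, `U_x = U_y = b(x)` the flux density `L₁ + L₂` is `R_α(u₀) b^α`. If the law
were trivial, the part vanishing on solutions would drop out along a map solving the system to high
order on the line, and the flux of the divergence-free part would not change when the map is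
deformed away from the boundary of a parallelogram. Deforming the data `b` into the data `0` gives
`∫ R_α(u₀) b^α dx = 0` for every compactly supported `b`, which is false for `b = χ R(u₀)`. Jets to
finite order suffice, so no existence theorem for genuine solutions enters. -/

theorem contDiffOn_fderiv {H E : Type*} [NormedAddCommGroup H] [NormedSpace ℝ H]
    [NormedAddCommGroup E] [NormedSpace ℝ E] {Ω : Set H} (hΩ : IsOpen Ω) {g : H → E}
    (hg : ContDiffOn ℝ ∞ g Ω) : ContDiffOn ℝ ∞ (fderiv ℝ g) Ω :=
  hg.fderiv_of_isOpen hΩ (by simp)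

theorem contDiffOn_fderiv_apply {H E : Type*} [NormedAddCommGroup H] [NormedSpace ℝ H]
    [NormedAddCommGroup E] [NormedSpace ℝ E] {Ω : Set H} (hΩ : IsOpen Ω) {g : H → E}
    (hg : ContDiffOn ℝ ∞ g Ω) (v : H) : ContDiffOn ℝ ∞ (fun z => fderiv ℝ g z v) Ω :=
  (contDiffOn_fderiv hΩ hg).clm_apply contDiffOn_const

/-! ### Smooth dependence of integrals on parameters. -/

section ParametricIntegral

variable {H E : Type} [NormedAddCommGroup H] [NormedSpace ℝ H]
    [NormedAddCommGroup E] [NormedSpace ℝ E]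

theorem ContDiffOn.hasFDerivAt_intervalIntegral {Ω : Set (ℝ × H)} (hΩ : IsOpen Ω) {g : ℝ × H → E}
    (hg : ContDiffOn ℝ ∞ g Ω) {u : H} (hu : ∀ t ∈ Icc (0 : ℝ) 1, (t, u) ∈ Ω) :
    HasFDerivAt (fun v => ∫ t in (0 : ℝ)..1, g (t, v))
      (∫ t in (0 : ℝ)..1, (fderiv ℝ g (t, u)).comp (ContinuousLinearMap.inr ℝ ℝ H)) u := by
  have hD : ContinuousOn (fun z => (fderiv ℝ g z).comp (ContinuousLinearMap.inr ℝ ℝ H)) Ω :=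
    ((contDiffOn_fderiv hΩ hg).continuousOn).clm_comp continuousOn_const
  have hline : ∀ v : H, (∀ t ∈ Icc (0 : ℝ) 1, (t, v) ∈ Ω) → ∀ {F : Type} [NormedAddCommGroup F]
      (k : ℝ × H → F), ContinuousOn k Ω → ContinuousOn (fun t => k (t, v)) (Icc 0 1) := by
    intro v hv F _ k hk
    exact hk.comp (by fun_prop) (fun t ht => hv t ht)
  obtain ⟨C, hC⟩ := (isCompact_Icc (a := (0 : ℝ)) (b := 1)).exists_bound_of_continuousOn
    (hline u hu _ hD)
  -- The derivative is bounded by `C` over the segment above `u`; the tube lemma then gives one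
  -- neighbourhood of `u` on which `C + 1` bounds it for all `t` at once, the constant needed for
  -- dominated differentiation.
  have hO : IsOpen (Ω ∩ (fun z => ‖(fderiv ℝ g z).comp (ContinuousLinearMap.inr ℝ ℝ H)‖) ⁻¹'
      Iio (C + 1)) := hD.norm.isOpen_inter_preimage hΩ isOpen_Iio
  obtain ⟨U, V, hU, hV, hIU, huV, hUV⟩ := generalized_tube_lemma
    (isCompact_Icc (a := (0 : ℝ)) (b := 1)) (isCompact_singleton (x := u)) hO (by
      rintro ⟨t, v⟩ ⟨ht, hv⟩
      obtain rfl : v = u := hv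
      exact ⟨hu t ht, by simpa using lt_of_le_of_lt (hC t ht) (lt_add_one C)⟩)
  have hVn : V ∈ 𝓝 u := hV.mem_nhds (huV rfl)
  have hVΩ : ∀ v ∈ V, ∀ t ∈ Icc (0 : ℝ) 1, (t, v) ∈ Ω := fun v hv t ht =>
    (hUV (⟨hIU ht, hv⟩ : (t, v) ∈ U ×ˢ V)).1
  have hI : Ι (0 : ℝ) 1 ⊆ Icc 0 1 := by
    rw [uIoc_of_le zero_le_one]; exact Ioc_subset_Icc_self
  refine intervalIntegral.hasFDerivAt_integral_of_dominated_of_fderiv_le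
    (F := fun v t => g (t, v)) (bound := fun _ => C + 1)
    (F' := fun v t => (fderiv ℝ g (t, v)).comp (ContinuousLinearMap.inr ℝ ℝ H)) hVn ?_ ?_ ?_ ?_ ?_ ?_
  · filter_upwards [hVn] with v hv
    exact ((hline v (hVΩ v hv) g hg.continuousOn).mono hI).aestronglyMeasurable
      measurableSet_uIoc
  · apply ContinuousOn.intervalIntegrable
    rw [uIcc_of_le zero_le_one]
    exact hline u hu g hg.continuousOn
  · exact ((hline u hu _ hD).mono hI).aestronglyMeasurable measurableSet_uIoc
  · refine Filter.Eventually.of_forall fun t ht v hv => ?_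
    exact le_of_lt (hUV (⟨hIU (hI ht), hv⟩ : (t, v) ∈ U ×ˢ V)).2
  · exact intervalIntegrable_const
  · refine Filter.Eventually.of_forall fun t ht v hv => ?_
    have h1 : HasFDerivAt g (fderiv ℝ g (t, v)) (t, v) :=
      ((hg.contDiffAt (hΩ.mem_nhds (hVΩ v hv t (hI ht)))).differentiableAt (by simp)).hasFDerivAt
    exact h1.comp v (hasFDerivAt_prodMk_right t v)

end ParametricIntegral

/-- The derivative of the integral is the integral of the derivative, whose values lie in `H →L[ℝ]
E`; the target space therefore has to vary in the induction on `k`. -/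
theorem contDiffOn_intervalIntegral_nat {H : Type} [NormedAddCommGroup H] [NormedSpace ℝ H]
    {Ω : Set (ℝ × H)} (hΩ : IsOpen Ω) {W : Set H} (hW : IsOpen W)
    (hWΩ : ∀ u ∈ W, ∀ t ∈ Icc (0 : ℝ) 1, (t, u) ∈ Ω) (k : ℕ) :
    ∀ (E : Type) [NormedAddCommGroup E] [NormedSpace ℝ E] (g : ℝ × H → E),
    ContDiffOn ℝ ∞ g Ω → ContDiffOn ℝ k (fun v => ∫ t in (0 : ℝ)..1, g (t, v)) W := by
  induction k with
  | zero =>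
    intro E _ _ g hg
    rw [Nat.cast_zero, contDiffOn_zero]
    exact fun u hu =>
      (ContDiffOn.hasFDerivAt_intervalIntegral hΩ hg (hWΩ u hu)).continuousAt.continuousWithinAt
  | succ k ih =>
    intro E _ _ g hg
    rw [Nat.cast_succ, contDiffOn_succ_iff_fderiv_of_isOpen hW]
    refine ⟨fun u hu => (ContDiffOn.hasFDerivAt_intervalIntegral hΩ hg
      (hWΩ u hu)).differentiableAt.differentiableWithinAt, by simp, ?_⟩
    refine (ih _ (fun z => (fderiv ℝ g z).comp (ContinuousLinearMap.inr ℝ ℝ H))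
      ((contDiffOn_fderiv hΩ hg).clm_comp contDiffOn_const)).congr fun u hu => ?_
    exact (ContDiffOn.hasFDerivAt_intervalIntegral hΩ hg (hWΩ u hu)).fderiv

theorem contDiffOn_intervalIntegral {H E : Type} [NormedAddCommGroup H] [NormedSpace ℝ H]
    [NormedAddCommGroup E] [NormedSpace ℝ E]
    {Ω : Set (ℝ × H)} (hΩ : IsOpen Ω) {W : Set H} (hW : IsOpen W)
    (hWΩ : ∀ u ∈ W, ∀ t ∈ Icc (0 : ℝ) 1, (t, u) ∈ Ω) {g : ℝ × H → E}
    (hg : ContDiffOn ℝ ∞ g Ω) : ContDiffOn ℝ ∞ (fun v => ∫ t in (0 : ℝ)..1, g (t, v)) W :=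
  contDiffOn_infty.2 fun k => contDiffOn_intervalIntegral_nat hΩ hW hWΩ k E g hg

/-! ### The Poincaré lemma for 2-forms. -/

theorem fderiv_eq_sum_pderiv {n : ℕ} (h : (Fin n → ℝ) → ℝ) (u v : Fin n → ℝ) :
    fderiv ℝ h u v = ∑ β, v β * pderiv β h u := by
  conv_lhs => rw [← Finset.univ_sum_single v]
  rw [map_sum]
  refine Finset.sum_congr rfl fun β _ => ?_
  have : (Pi.single β (v β) : Fin n → ℝ) = v β • Pi.single β 1 := by
    rw [← Pi.single_smul]; simp
  rw [this, map_smul]; rfl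

theorem contDiffOn_pderiv {n : ℕ} {W : Set (Fin n → ℝ)} (hW : IsOpen W) {h : (Fin n → ℝ) → ℝ}
    (hh : ContDiffOn ℝ ∞ h W) (α : Fin n) : ContDiffOn ℝ ∞ (pderiv α h) W :=
  contDiffOn_fderiv_apply hW hh _

/-- The Poincaré lemma for closed 2-forms on an open star-shaped set. -/
theorem exists_potential_of_closed {n : ℕ} {W : Set (Fin n → ℝ)} (hW : IsOpen W) {c : Fin n → ℝ}
    (hcW : StarConvex ℝ c W) {w : Fin n → Fin n → (Fin n → ℝ) → ℝ}
    (hw : ∀ α β, ContDiffOn ℝ ∞ (w α β) W) (hanti : ∀ u ∈ W, ∀ α β, w α β u = - w β α u)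
    (hclosed : ∀ u ∈ W, ∀ α β γ,
      pderiv α (w β γ) u + pderiv β (w γ α) u + pderiv γ (w α β) u = 0) :
    ∃ Ω : Fin n → (Fin n → ℝ) → ℝ, (∀ α, ContDiffOn ℝ ∞ (Ω α) W) ∧
      ∀ u ∈ W, ∀ α β, pderiv α (Ω β) u - pderiv β (Ω α) u = w α β u := by
  set O : Set (ℝ × (Fin n → ℝ)) := (fun z => c + z.1 • (z.2 - c)) ⁻¹' W with hO
  have hOo : IsOpen O := hW.preimage (by fun_prop)
  have hWO : ∀ u ∈ W, ∀ t ∈ Icc (0 : ℝ) 1, (t, u) ∈ O := fun u hu t ht =>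
    hcW.add_smul_sub_mem hu ht.1 ht.2
  have hwc : ∀ α β, ContDiffOn ℝ ∞ (fun z : ℝ × (Fin n → ℝ) => w α β (c + z.1 • (z.2 - c))) O :=
    fun α β => (hw α β).comp (by fun_prop) (fun z hz => hz)
  -- The integrand of the homotopy operator: contract `w` with the radial field based at `c`, pulled
  -- back along the contraction to `c`.
  set g : Fin n → ℝ × (Fin n → ℝ) → ℝ :=
    fun γ z => z.1 * ∑ β, w β γ (c + z.1 • (z.2 - c)) * (z.2 β - c β) with hg
  have hgs : ∀ γ, ContDiffOn ℝ ∞ (g γ) O := by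
    intro γ
    refine contDiffOn_fst.mul (ContDiffOn.sum fun β _ => (hwc β γ).mul ?_)
    fun_prop
  refine ⟨fun γ u => ∫ t in (0 : ℝ)..1, g γ (t, u),
    fun γ => contDiffOn_intervalIntegral hOo hW hWO (hgs γ), ?_⟩
  intro u hu α γ
  have hdw : ∀ t ∈ Icc (0 : ℝ) 1, ∀ β γ, HasFDerivAt (w β γ)
      (fderiv ℝ (w β γ) (c + t • (u - c))) (c + t • (u - c)) := fun t ht β γ =>
    (((hw β γ).contDiffAt (hW.mem_nhds (hWO u hu t ht))).differentiableAt
      (by simp)).hasFDerivAt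
  have hval : ∀ t ∈ Icc (0 : ℝ) 1, ∀ α γ, fderiv ℝ (g γ) (t, u) (0, Pi.single α 1) =
      t * (∑ β, t * pderiv α (w β γ) (c + t • (u - c)) * (u β - c β)
        + w α γ (c + t • (u - c))) := by
    intro t ht α γ
    have h1 : HasFDerivAt (g γ) (fderiv ℝ (g γ) (t, u)) (t, u) :=
      (((hgs γ).contDiffAt (hOo.mem_nhds (hWO u hu t ht))).differentiableAt (by simp)).hasFDerivAt
    have hl : HasDerivAt (fun s : ℝ => ((t, u) + s • (0, Pi.single α 1) : ℝ × (Fin n → ℝ)))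
        (0, Pi.single α 1) 0 := by
      simpa using ((hasDerivAt_id (0 : ℝ)).smul_const
        ((0, Pi.single α 1) : ℝ × (Fin n → ℝ))).const_add (t, u)
    have h2 := (show HasFDerivAt (g γ) (fderiv ℝ (g γ) (t, u))
      ((t, u) + (0 : ℝ) • (0, Pi.single α 1)) by simpa using h1).comp_hasDerivAt (0 : ℝ) hl
    refine h2.unique ?_
    have hl2 : HasDerivAt (fun s : ℝ => c + t • (u + s • Pi.single α (1 : ℝ) - c))
        (t • Pi.single α 1) 0 := by
      simpa using ((((hasDerivAt_id (0 : ℝ)).smul_const (Pi.single α (1 : ℝ) : Fin n → ℝ)).const_add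
        u).sub_const c).const_smul t |>.const_add c
    have h3 : ∀ β, HasDerivAt (fun s : ℝ => w β γ (c + t • (u + s • Pi.single α (1 : ℝ) - c)))
        (t * pderiv α (w β γ) (c + t • (u - c))) 0 := by
      intro β
      have := (show HasFDerivAt (w β γ) (fderiv ℝ (w β γ) (c + t • (u - c)))
        (c + t • (u + (0 : ℝ) • Pi.single α (1 : ℝ) - c)) by
          simpa using hdw t ht β γ).comp_hasDerivAt (0 : ℝ) hl2
      exact this.congr_deriv (by simp [pderiv])
    have h4 : ∀ β, HasDerivAt (fun s : ℝ => (u + s • (Pi.single α 1 : Fin n → ℝ)) β - c β)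
        ((Pi.single α 1 : Fin n → ℝ) β) 0 := by
      intro β
      simpa using ((((hasDerivAt_id (0 : ℝ)).mul_const ((Pi.single α 1 : Fin n → ℝ) β)).const_add
        (u β)).sub_const (c β))
    have h5 := (HasDerivAt.fun_sum (u := Finset.univ)
      fun β _ => (h3 β).fun_mul (h4 β)).const_mul t
    refine (h5.congr_deriv ?_).congr_of_eventuallyEq (Filter.Eventually.of_forall fun s => ?_)
    · simp [Finset.sum_add_distrib, Pi.single_apply]
    · simp [g]
  have hpd : ∀ α γ, pderiv α (fun u => ∫ t in (0 : ℝ)..1, g γ (t, u)) u =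
      ∫ t in (0 : ℝ)..1, fderiv ℝ (g γ) (t, u) (0, Pi.single α 1) := by
    intro α γ
    rw [pderiv, (ContDiffOn.hasFDerivAt_intervalIntegral hOo (hgs γ) (hWO u hu)).fderiv,
      ContinuousLinearMap.intervalIntegral_apply]
    · rfl
    · apply ContinuousOn.intervalIntegrable
      rw [uIcc_of_le zero_le_one]
      exact (((contDiffOn_fderiv hOo (hgs γ)).continuousOn).clm_comp continuousOn_const).comp
        (by fun_prop) (fun t ht => hWO u hu t ht)
  have hint : ∀ α γ, IntervalIntegrable
      (fun t => fderiv ℝ (g γ) (t, u) (0, Pi.single α 1)) volume 0 1 := by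
    intro α γ
    apply ContinuousOn.intervalIntegrable
    rw [uIcc_of_le zero_le_one]
    exact (contDiffOn_fderiv_apply hOo (hgs γ) _).continuousOn.comp
      (by fun_prop) (fun t ht => hWO u hu t ht)
  -- By closedness the antisymmetrised derivative of the integrand is `d/dt (t² w(c + t(u - c)))`,
  -- so its integral over `[0, 1]` is the value of `w` at `u`.
  have hder : ∀ t ∈ [[(0 : ℝ), 1]], HasDerivAt (fun t : ℝ => t ^ 2 * w α γ (c + t • (u - c)))
      (fderiv ℝ (g γ) (t, u) (0, Pi.single α 1) - fderiv ℝ (g α) (t, u) (0, Pi.single γ 1)) t := by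
    intro t ht
    rw [uIcc_of_le zero_le_one] at ht
    have hl : HasDerivAt (fun t : ℝ => c + t • (u - c)) (u - c) t := by
      simpa using ((hasDerivAt_id t).smul_const (u - c)).const_add c
    have h1 := (hdw t ht α γ).comp_hasDerivAt t hl
    have h2 := (hasDerivAt_pow 2 t).fun_mul h1
    refine h2.congr_deriv ?_
    symm
    have hz := hWO u hu t ht
    rw [hval t ht, hval t ht, fderiv_eq_sum_pderiv, hanti _ hz γ α]
    have key : ∀ β, pderiv α (w β γ) (c + t • (u - c)) - pderiv γ (w β α) (c + t • (u - c)) =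
        pderiv β (w α γ) (c + t • (u - c)) := by
      intro β
      have e1 := hclosed _ hz α β γ
      have hneg : ∀ a b d, pderiv d (w a b) (c + t • (u - c)) =
          - pderiv d (w b a) (c + t • (u - c)) := by
        intro a b d
        have : w a b =ᶠ[𝓝 (c + t • (u - c))] fun v => - w b a v := by
          filter_upwards [hW.mem_nhds hz] with v hv using hanti v hv a b
        rw [pderiv, this.fderiv_eq, fderiv_fun_neg]; rfl
      rw [hneg γ α, hneg α β] at e1
      linarith
    have : ∑ β, (u - c) β * pderiv β (w α γ) (c + t • (u - c)) =
        ∑ β, pderiv α (w β γ) (c + t • (u - c)) * (u β - c β) -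
        ∑ β, pderiv γ (w β α) (c + t • (u - c)) * (u β - c β) := by
      rw [← Finset.sum_sub_distrib]
      refine Finset.sum_congr rfl fun β _ => ?_
      rw [← key, Pi.sub_apply]; ring
    rw [this]
    simp only [mul_assoc, ← Finset.mul_sum]
    simp
    ring
  rw [hpd, hpd, ← intervalIntegral.integral_sub (hint _ _) (hint _ _),
    intervalIntegral.integral_eq_sub_of_hasDerivAt hder ((hint _ _).sub (hint _ _))]
  simp

end ChiralType

/-! ### Total derivatives on truncated jets. -/

noncomputable section

namespace ChiralType

variable {n : ℕ}

/-- The line through the jet `p` in the direction of the total derivative `D_x`. -/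
def Jet.shiftX (p : Jet n) (t : ℝ) : Jet n :=
  ⟨p.x + t, p.y, fun i j α => p.u i j α + t * p.u (i + 1) j α⟩

/-- The line through the jet `p` in the direction of the total derivative `D_y`. -/
def Jet.shiftY (p : Jet n) (t : ℝ) : Jet n :=
  ⟨p.x, p.y + t, fun i j α => p.u i j α + t * p.u i (j + 1) α⟩

/-- The truncated jet space. -/
abbrev TruncJet (n k : ℕ) : Type := ℝ × ℝ × (Fin (k + 1) → Fin (k + 1) → Fin n → ℝ)

/-- Forget the coordinates of top order. -/
def TruncJet.restrict {k : ℕ} (q : TruncJet n (k + 1)) : TruncJet n k :=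
  (q.1, q.2.1, fun i j => q.2.2 i.castSucc j.castSucc)

/-- The direction of `D_x` in the truncated jet space. -/
def TruncJet.velX {k : ℕ} (q : TruncJet n (k + 1)) : TruncJet n k :=
  (1, 0, fun i j => q.2.2 i.succ j.castSucc)

/-- The direction of `D_y` in the truncated jet space. -/
def TruncJet.velY {k : ℕ} (q : TruncJet n (k + 1)) : TruncJet n k :=
  (0, 1, fun i j => q.2.2 i.castSucc j.succ)

theorem Jet.trunc_shiftX (k : ℕ) (p : Jet n) (t : ℝ) :
    (p.shiftX t).trunc k = p.trunc k + t • (TruncJet.velX (p.trunc (k + 1))) := by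
  refine Prod.ext ?_ (Prod.ext ?_ ?_)
  · simp [Jet.trunc, Jet.shiftX, TruncJet.velX]
  · simp [Jet.trunc, Jet.shiftX, TruncJet.velX]
  · funext i j α
    simp [Jet.trunc, Jet.shiftX, TruncJet.velX]

theorem Jet.trunc_shiftY (k : ℕ) (p : Jet n) (t : ℝ) :
    (p.shiftY t).trunc k = p.trunc k + t • (TruncJet.velY (p.trunc (k + 1))) := by
  refine Prod.ext ?_ (Prod.ext ?_ ?_)
  · simp [Jet.trunc, Jet.shiftY, TruncJet.velY]
  · simp [Jet.trunc, Jet.shiftY, TruncJet.velY]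
  · funext i j α
    simp [Jet.trunc, Jet.shiftY, TruncJet.velY]

theorem isOpen_truncJet_over {W : Set (Fin n → ℝ)} (hW : IsOpen W) (k : ℕ) :
    IsOpen {q : TruncJet n k | q.2.2 0 0 ∈ W} :=
  hW.preimage (by fun_prop)

theorem eventually_shiftX_mem {W : Set (Fin n → ℝ)} (hW : IsOpen W) {p : Jet n}
    (hp : p.u 0 0 ∈ W) : ∀ᶠ t in 𝓝 (0 : ℝ), (p.shiftX t).u 0 0 ∈ W := by
  have hc : Continuous fun t : ℝ => (p.shiftX t).u 0 0 := by
    simp only [Jet.shiftX]; fun_prop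
  exact hc.continuousAt.preimage_mem_nhds (hW.mem_nhds (by simpa [Jet.shiftX] using hp))

theorem eventually_shiftY_mem {W : Set (Fin n → ℝ)} (hW : IsOpen W) {p : Jet n}
    (hp : p.u 0 0 ∈ W) : ∀ᶠ t in 𝓝 (0 : ℝ), (p.shiftY t).u 0 0 ∈ W := by
  have hc : Continuous fun t : ℝ => (p.shiftY t).u 0 0 := by
    simp only [Jet.shiftY]; fun_prop
  exact hc.continuousAt.preimage_mem_nhds (hW.mem_nhds (by simpa [Jet.shiftY] using hp))

section Representative

variable {W : Set (Fin n → ℝ)} {F : Jet n → ℝ} {k : ℕ} {φ : TruncJet n k → ℝ}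

/-- On functions of finitely many coordinates, `D_x` is an ordinary directional derivative; its
direction involves one more order of derivatives, hence the truncation at `k + 1`. -/
theorem hasDerivAt_shiftX (hW : IsOpen W) (hφ : ContDiffOn ℝ ∞ φ {q | q.2.2 0 0 ∈ W})
    (hF : ∀ p : Jet n, p.u 0 0 ∈ W → F p = φ (p.trunc k)) {p : Jet n} (hp : p.u 0 0 ∈ W) :
    HasDerivAt (fun t => F (p.shiftX t))
      (fderiv ℝ φ (p.trunc k) (TruncJet.velX (p.trunc (k + 1)))) 0 := by
  have h1 : HasFDerivAt φ (fderiv ℝ φ (p.trunc k))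
      (p.trunc k + (0 : ℝ) • (TruncJet.velX (p.trunc (k + 1)))) := by
    rw [zero_smul, add_zero]
    exact ((hφ.contDiffAt ((isOpen_truncJet_over hW k).mem_nhds hp)).differentiableAt
      (by simp)).hasFDerivAt
  have h2 : HasDerivAt (fun t : ℝ => p.trunc k + t • (TruncJet.velX (p.trunc (k + 1))))
      (TruncJet.velX (p.trunc (k + 1))) 0 := by
    simpa using ((hasDerivAt_id (0 : ℝ)).smul_const (TruncJet.velX (p.trunc (k + 1)))).const_add (p.trunc k)
  refine (h1.comp_hasDerivAt (0 : ℝ) h2).congr_of_eventuallyEq ?_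
  filter_upwards [eventually_shiftX_mem hW hp] with t ht
  rw [hF _ ht, Jet.trunc_shiftX]; rfl

theorem hasDerivAt_shiftY (hW : IsOpen W) (hφ : ContDiffOn ℝ ∞ φ {q | q.2.2 0 0 ∈ W})
    (hF : ∀ p : Jet n, p.u 0 0 ∈ W → F p = φ (p.trunc k)) {p : Jet n} (hp : p.u 0 0 ∈ W) :
    HasDerivAt (fun t => F (p.shiftY t))
      (fderiv ℝ φ (p.trunc k) (TruncJet.velY (p.trunc (k + 1)))) 0 := by
  have h1 : HasFDerivAt φ (fderiv ℝ φ (p.trunc k))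
      (p.trunc k + (0 : ℝ) • (TruncJet.velY (p.trunc (k + 1)))) := by
    rw [zero_smul, add_zero]
    exact ((hφ.contDiffAt ((isOpen_truncJet_over hW k).mem_nhds hp)).differentiableAt
      (by simp)).hasFDerivAt
  have h2 : HasDerivAt (fun t : ℝ => p.trunc k + t • (TruncJet.velY (p.trunc (k + 1))))
      (TruncJet.velY (p.trunc (k + 1))) 0 := by
    simpa using ((hasDerivAt_id (0 : ℝ)).smul_const (TruncJet.velY (p.trunc (k + 1)))).const_add (p.trunc k)
  refine (h1.comp_hasDerivAt (0 : ℝ) h2).congr_of_eventuallyEq ?_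
  filter_upwards [eventually_shiftY_mem hW hp] with t ht
  rw [hF _ ht, Jet.trunc_shiftY]; rfl

end Representative

namespace IsDifferentialFunction

variable {W : Set (Fin n → ℝ)} {F : Jet n → ℝ}

theorem hasDerivAt_Dy (hF : IsDifferentialFunction W F) (hW : IsOpen W) {p : Jet n}
    (hp : p.u 0 0 ∈ W) : HasDerivAt (fun t => F (p.shiftY t)) (Dy F p) 0 := by
  obtain ⟨k, φ, hφ, h⟩ := hF
  exact (hasDerivAt_shiftY hW hφ h hp).differentiableAt.hasDerivAt

theorem Dx (hF : IsDifferentialFunction W F) (hW : IsOpen W) :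
    IsDifferentialFunction W (Dx F) := by
  obtain ⟨k, φ, hφ, h⟩ := hF
  refine ⟨k + 1, fun q => fderiv ℝ φ (TruncJet.restrict q) (TruncJet.velX q), ?_, fun p hp => ?_⟩
  · refine ((contDiffOn_fderiv (isOpen_truncJet_over hW k) hφ).comp
      (g := fderiv ℝ φ) (f := TruncJet.restrict) ?_ fun q hq => hq).clm_apply ?_
    · unfold TruncJet.restrict; fun_prop
    · unfold TruncJet.velX; fun_prop
  · exact (hasDerivAt_shiftX hW hφ h hp).deriv

theorem Dy (hF : IsDifferentialFunction W F) (hW : IsOpen W) :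
    IsDifferentialFunction W (Dy F) := by
  obtain ⟨k, φ, hφ, h⟩ := hF
  refine ⟨k + 1, fun q => fderiv ℝ φ (TruncJet.restrict q) (TruncJet.velY q), ?_, fun p hp => ?_⟩
  · refine ((contDiffOn_fderiv (isOpen_truncJet_over hW k) hφ).comp
      (g := fderiv ℝ φ) (f := TruncJet.restrict) ?_ fun q hq => hq).clm_apply ?_
    · unfold TruncJet.restrict; fun_prop
    · unfold TruncJet.velY; fun_prop
  · exact (hasDerivAt_shiftY hW hφ h hp).deriv

theorem iterate_Dx (hF : IsDifferentialFunction W F) (hW : IsOpen W) (i : ℕ) :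
    IsDifferentialFunction W (ChiralType.Dx^[i] F) := by
  induction i with
  | zero => exact hF
  | succ i ih => rw [Function.iterate_succ_apply']; exact ih.Dx hW

theorem iterate_Dy (hF : IsDifferentialFunction W F) (hW : IsOpen W) (i : ℕ) :
    IsDifferentialFunction W (ChiralType.Dy^[i] F) := by
  induction i with
  | zero => exact hF
  | succ i ih => rw [Function.iterate_succ_apply']; exact ih.Dy hW

end IsDifferentialFunction

theorem isDifferentialFunction_chiralDelta {W : Set (Fin n → ℝ)}
    {G : Fin n → Fin n → Fin n → (Fin n → ℝ) → ℝ} {Q : Fin n → (Fin n → ℝ) → ℝ}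
    (hG : ∀ α β γ, ContDiffOn ℝ ∞ (G α β γ) W) (hQ : ∀ α, ContDiffOn ℝ ∞ (Q α) W) (α : Fin n) :
    IsDifferentialFunction W (chiralDelta G Q α) := by
  have h0 : ∀ h : (Fin n → ℝ) → ℝ, ContDiffOn ℝ ∞ h W →
      ContDiffOn ℝ ∞ (fun q : TruncJet n 1 => h (q.2.2 0 0)) {q | q.2.2 0 0 ∈ W} := fun h hh =>
    hh.comp (by fun_prop) fun q hq => hq
  refine ⟨1, fun q => q.2.2 1 1 α + (∑ β, ∑ γ, G α β γ (q.2.2 0 0) * q.2.2 1 0 β * q.2.2 0 1 γ) +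
    Q α (q.2.2 0 0), ?_, fun p hp => rfl⟩
  refine (ContDiffOn.add (by fun_prop) (ContDiffOn.sum fun β _ => ContDiffOn.sum fun γ _ =>
    ((h0 _ (hG α β γ)).mul (by fun_prop)).mul (by fun_prop))).add (h0 _ (hQ α))

/-! ### Order of differential functions. -/

/-- Two jets at the same base point agree in all derivatives of total order at most `r`. -/
structure Jet.AgreeUpTo (r : ℕ) (p q : Jet n) : Prop where
  x_eq : p.x = q.x
  y_eq : p.y = q.y
  u_eq : ∀ i j, i + j ≤ r → p.u i j = q.u i j

theorem Jet.AgreeUpTo.mono {r s : ℕ} {p q : Jet n} (h : Jet.AgreeUpTo s p q) (hrs : r ≤ s) :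
    Jet.AgreeUpTo r p q :=
  ⟨h.x_eq, h.y_eq, fun i j hij => h.u_eq i j (hij.trans hrs)⟩

/-- `F` depends over `W` only on derivatives of total order at most `r`. -/
def HasOrderLE (W : Set (Fin n → ℝ)) (r : ℕ) (F : Jet n → ℝ) : Prop :=
  ∀ p q : Jet n, p.u 0 0 ∈ W → Jet.AgreeUpTo r p q → F p = F q

theorem IsDifferentialFunction.exists_hasOrderLE {W : Set (Fin n → ℝ)} {F : Jet n → ℝ}
    (hF : IsDifferentialFunction W F) : ∃ r, HasOrderLE W r F := by
  obtain ⟨k, φ, -, h⟩ := hF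
  -- Truncation keeps the square `i, j ≤ k`, which lies in the triangle `i + j ≤ 2k`.
  refine ⟨k + k, fun p q hp hpq => ?_⟩
  rw [h p hp, h q (by rwa [← hpq.u_eq 0 0 (Nat.zero_le _)])]
  congr 1
  refine Prod.ext hpq.x_eq (Prod.ext hpq.y_eq ?_)
  funext i j
  exact hpq.u_eq i j (by have := i.2; have := j.2; omega)

theorem HasOrderLE.Dx {W : Set (Fin n → ℝ)} (hW : IsOpen W) {F : Jet n → ℝ} {r : ℕ}
    (hF : HasOrderLE W r F) : HasOrderLE W (r + 1) (Dx F) := by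
  intro p q hp hpq
  refine Filter.EventuallyEq.deriv_eq (f := fun t => F (q.shiftX t)) ?_ |>.symm |> Eq.symm |>.trans rfl
  filter_upwards [eventually_shiftX_mem hW hp] with t ht
  refine hF _ _ ht ⟨by simp [Jet.shiftX, hpq.x_eq], hpq.y_eq, fun i j hij => ?_⟩
  funext α
  simp only [Jet.shiftX]
  rw [hpq.u_eq i j (by omega), hpq.u_eq (i + 1) j (by omega)]

theorem HasOrderLE.Dy {W : Set (Fin n → ℝ)} (hW : IsOpen W) {F : Jet n → ℝ} {r : ℕ}
    (hF : HasOrderLE W r F) : HasOrderLE W (r + 1) (Dy F) := by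
  intro p q hp hpq
  refine Filter.EventuallyEq.deriv_eq (f := fun t => F (q.shiftY t)) ?_ |>.trans rfl
  filter_upwards [eventually_shiftY_mem hW hp] with t ht
  refine hF _ _ ht ⟨hpq.x_eq, by simp [Jet.shiftY, hpq.y_eq], fun i j hij => ?_⟩
  funext α
  simp only [Jet.shiftY]
  rw [hpq.u_eq i j (by omega), hpq.u_eq i (j + 1) (by omega)]

theorem hasOrderLE_chiralDelta (W : Set (Fin n → ℝ))
    (G : Fin n → Fin n → Fin n → (Fin n → ℝ) → ℝ) (Q : Fin n → (Fin n → ℝ) → ℝ) (α : Fin n) :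
    HasOrderLE W 2 (chiralDelta G Q α) := by
  intro p q _ h
  simp only [chiralDelta, h.u_eq 1 1 le_rfl, h.u_eq 0 0 (by simp), h.u_eq 1 0 (by simp),
    h.u_eq 0 1 (by simp)]

theorem hasOrderLE_iterate_chiralDelta {W : Set (Fin n → ℝ)} (hW : IsOpen W)
    (G : Fin n → Fin n → Fin n → (Fin n → ℝ) → ℝ) (Q : Fin n → (Fin n → ℝ) → ℝ)
    (i j : ℕ) (α : Fin n) :
    HasOrderLE W (i + j + 2) (Dx^[i] (Dy^[j] (chiralDelta G Q α))) := by
  induction i with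
  | zero =>
    induction j with
    | zero => exact hasOrderLE_chiralDelta W G Q α
    | succ j ih =>
      simp only [Function.iterate_zero, id] at ih ⊢
      rw [Function.iterate_succ_apply', show 0 + (j + 1) + 2 = (0 + j + 2) + 1 by omega]
      exact ih.Dy hW
  | succ i ih =>
    rw [Function.iterate_succ_apply', show i + 1 + j + 2 = (i + j + 2) + 1 by omega]
    exact ih.Dx hW

/-- The derivative `D_y^m Δ^α` is `U^α_{1,m+1}` plus terms of lower order. -/
theorem hasOrderLE_iterate_Dy_sub {W : Set (Fin n → ℝ)} (hW : IsOpen W)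
    {G : Fin n → Fin n → Fin n → (Fin n → ℝ) → ℝ} {Q : Fin n → (Fin n → ℝ) → ℝ}
    (hG : ∀ α β γ, ContDiffOn ℝ ∞ (G α β γ) W) (hQ : ∀ α, ContDiffOn ℝ ∞ (Q α) W) (α : Fin n)
    (m : ℕ) :
    HasOrderLE W (m + 1) (fun p => (Dy^[m] (chiralDelta G Q α)) p - p.u 1 (m + 1) α) := by
  induction m with
  | zero =>
    intro p q _ h
    simp only [Function.iterate_zero, id, chiralDelta, h.u_eq 0 0 (by simp), h.u_eq 1 0 (by simp),
      h.u_eq 0 1 (by simp)]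
    ring
  | succ m ih =>
    have key : ∀ p : Jet n, p.u 0 0 ∈ W →
        Dy (fun p => (Dy^[m] (chiralDelta G Q α)) p - p.u 1 (m + 1) α) p =
          (Dy^[m + 1] (chiralDelta G Q α)) p - p.u 1 (m + 1 + 1) α := by
      intro p hp
      have h1 := ((isDifferentialFunction_chiralDelta hG hQ α).iterate_Dy hW m).hasDerivAt_Dy hW hp
      have h2 : HasDerivAt (fun t => (p.shiftY t).u 1 (m + 1) α) (p.u 1 (m + 1 + 1) α) 0 := by
        simpa [Jet.shiftY] using ((hasDerivAt_id (0 : ℝ)).mul_const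
          (p.u 1 (m + 1 + 1) α)).const_add (p.u 1 (m + 1) α)
      rw [Function.iterate_succ_apply']
      exact (h1.sub h2).deriv
    intro p q hp h
    beta_reduce
    rw [← key p hp, ← key q (by rwa [← h.u_eq 0 0 (Nat.zero_le _)])]
    exact ih.Dy hW p q hp h

/-! ### Partial derivatives in the plane and jets of maps. -/

/-- Partial derivative in the first variable. -/
def px {E : Type*} [NormedAddCommGroup E] [NormedSpace ℝ E] (g : ℝ × ℝ → E) (z : ℝ × ℝ) : E :=
  fderiv ℝ g z (1, 0)

/-- Partial derivative in the second variable. -/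
def py {E : Type*} [NormedAddCommGroup E] [NormedSpace ℝ E] (g : ℝ × ℝ → E) (z : ℝ × ℝ) : E :=
  fderiv ℝ g z (0, 1)

section Plane

variable {E : Type*} [NormedAddCommGroup E] [NormedSpace ℝ E] {O : Set (ℝ × ℝ)} {g h : ℝ × ℝ → E}

theorem ContDiffOn.px (hO : IsOpen O) (hg : ContDiffOn ℝ ∞ g O) : ContDiffOn ℝ ∞ (px g) O :=
  contDiffOn_fderiv_apply hO hg _

theorem ContDiffOn.py (hO : IsOpen O) (hg : ContDiffOn ℝ ∞ g O) : ContDiffOn ℝ ∞ (py g) O :=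
  contDiffOn_fderiv_apply hO hg _

theorem ContDiffOn.iterate_px (hO : IsOpen O) (hg : ContDiffOn ℝ ∞ g O) (i : ℕ) :
    ContDiffOn ℝ ∞ (ChiralType.px^[i] g) O := by
  induction i with
  | zero => exact hg
  | succ i ih => rw [Function.iterate_succ_apply']; exact ContDiffOn.px hO ih

theorem ContDiffOn.iterate_py (hO : IsOpen O) (hg : ContDiffOn ℝ ∞ g O) (i : ℕ) :
    ContDiffOn ℝ ∞ (ChiralType.py^[i] g) O := by
  induction i with
  | zero => exact hg
  | succ i ih => rw [Function.iterate_succ_apply']; exact ContDiffOn.py hO ih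

theorem eqOn_px (hO : IsOpen O) (hgh : EqOn g h O) : EqOn (px g) (px h) O := fun z hz => by
  rw [px, px, Filter.EventuallyEq.fderiv_eq (hgh.eventuallyEq_of_mem (hO.mem_nhds hz))]

theorem eqOn_py (hO : IsOpen O) (hgh : EqOn g h O) : EqOn (py g) (py h) O := fun z hz => by
  rw [py, py, Filter.EventuallyEq.fderiv_eq (hgh.eventuallyEq_of_mem (hO.mem_nhds hz))]

theorem eqOn_iterate_px (hO : IsOpen O) (hgh : EqOn g h O) (i : ℕ) :
    EqOn (px^[i] g) (px^[i] h) O := by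
  induction i with
  | zero => exact hgh
  | succ i ih => rw [Function.iterate_succ_apply', Function.iterate_succ_apply']; exact eqOn_px hO ih

theorem eqOn_iterate_py (hO : IsOpen O) (hgh : EqOn g h O) (i : ℕ) :
    EqOn (py^[i] g) (py^[i] h) O := by
  induction i with
  | zero => exact hgh
  | succ i ih => rw [Function.iterate_succ_apply', Function.iterate_succ_apply']; exact eqOn_py hO ih

theorem eqOn_py_px (hO : IsOpen O) (hg : ContDiffOn ℝ ∞ g O) : EqOn (py (px g)) (px (py g)) O := by
  intro z hz
  have hgz : ContDiffAt ℝ ∞ g z := hg.contDiffAt (hO.mem_nhds hz)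
  have hs : IsSymmSndFDerivAt ℝ g z := hgz.isSymmSndFDerivAt (by simp; exact WithTop.coe_le_coe.2 le_top)
  have hd : DifferentiableAt ℝ (fderiv ℝ g) z :=
    ((contDiffOn_fderiv hO hg).contDiffAt (hO.mem_nhds hz)).differentiableAt (by simp)
  have hv : ∀ v w : ℝ × ℝ, fderiv ℝ (fun z => fderiv ℝ g z v) z w =
      fderiv ℝ (fderiv ℝ g) z w v := fun v w => by
    rw [fderiv_clm_apply hd (differentiableAt_const v)]
    simp
  change fderiv ℝ (fun z => fderiv ℝ g z (1, 0)) z (0, 1) =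
    fderiv ℝ (fun z => fderiv ℝ g z (0, 1)) z (1, 0)
  rw [hv, hv]
  exact hs _ _

theorem eqOn_py_iterate_px (hO : IsOpen O) (hg : ContDiffOn ℝ ∞ g O) (i : ℕ) :
    EqOn (py (px^[i] g)) (px^[i] (py g)) O := by
  induction i with
  | zero => exact fun z _ => rfl
  | succ i ih =>
    rw [Function.iterate_succ_apply', Function.iterate_succ_apply']
    exact (eqOn_py_px hO (ContDiffOn.iterate_px hO hg i)).trans (eqOn_px hO ih)

end Plane

/-- The infinite jet of the map `f` at `z`. -/
def jetOf (f : ℝ × ℝ → Fin n → ℝ) (z : ℝ × ℝ) : Jet n :=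
  ⟨z.1, z.2, fun i j => (px^[i] (py^[j] f)) z⟩

theorem contDiff_iterate {f : ℝ × ℝ → Fin n → ℝ} (hf : ContDiff ℝ ∞ f) (i j : ℕ) :
    ContDiff ℝ ∞ (px^[i] (py^[j] f)) :=
  contDiffOn_univ.1 (ContDiffOn.iterate_px isOpen_univ
    (ContDiffOn.iterate_py isOpen_univ hf.contDiffOn j) i)

theorem contDiff_trunc_jetOf {f : ℝ × ℝ → Fin n → ℝ} (hf : ContDiff ℝ ∞ f) (k : ℕ) :
    ContDiff ℝ ∞ (fun z => (jetOf f z).trunc k) :=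
  contDiff_fst.prodMk (contDiff_snd.prodMk (contDiff_pi.2 fun i => contDiff_pi.2 fun j =>
    contDiff_iterate hf i j))

theorem fderiv_trunc_jetOf {f : ℝ × ℝ → Fin n → ℝ} (hf : ContDiff ℝ ∞ f) (k : ℕ) (z v : ℝ × ℝ) :
    fderiv ℝ (fun z => (jetOf f z).trunc k) z v =
      (v.1, v.2, fun i j : Fin (k + 1) => fderiv ℝ (px^[(i : ℕ)] (py^[(j : ℕ)] f)) z v) := by
  have hc : ∀ i j : Fin (k + 1), HasFDerivAt (px^[(i : ℕ)] (py^[(j : ℕ)] f))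
      (fderiv ℝ (px^[(i : ℕ)] (py^[(j : ℕ)] f)) z) z := fun i j =>
    ((contDiff_iterate hf i j).differentiable (by simp) z).hasFDerivAt
  have h := (hasFDerivAt_fst (𝕜 := ℝ) (p := z)).prodMk ((hasFDerivAt_snd (𝕜 := ℝ) (p := z)).prodMk
    (hasFDerivAt_pi.2 fun i => hasFDerivAt_pi.2 fun j => hc i j))
  rw [show fderiv ℝ (fun z => (jetOf f z).trunc k) z = _ from h.fderiv]
  rfl

namespace IsDifferentialFunction

variable {W : Set (Fin n → ℝ)} {F : Jet n → ℝ} {f : ℝ × ℝ → Fin n → ℝ}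

theorem contDiffOn_comp_jetOf (hF : IsDifferentialFunction W F) (hf : ContDiff ℝ ∞ f) :
    ContDiffOn ℝ ∞ (fun z => F (jetOf f z)) (f ⁻¹' W) := by
  obtain ⟨k, φ, hφ, h⟩ := hF
  exact (hφ.comp (contDiff_trunc_jetOf hf k).contDiffOn fun z hz => hz).congr fun z hz => h _ hz

theorem px_comp_jetOf (hF : IsDifferentialFunction W F) (hW : IsOpen W) (hf : ContDiff ℝ ∞ f) :
    EqOn (px fun z => F (jetOf f z)) (fun z => ChiralType.Dx F (jetOf f z)) (f ⁻¹' W) := by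
  intro z hz
  obtain ⟨k, φ, hφ, h⟩ := hF
  have h1 : (fun z => F (jetOf f z)) =ᶠ[𝓝 z] fun z => φ ((jetOf f z).trunc k) := by
    filter_upwards [(hW.preimage hf.continuous).mem_nhds hz] with y hy using h _ hy
  have hφz : DifferentiableAt ℝ φ ((jetOf f z).trunc k) :=
    (hφ.contDiffAt ((isOpen_truncJet_over hW k).mem_nhds hz)).differentiableAt (by simp)
  rw [px, h1.fderiv_eq, fderiv_fun_comp z hφz
    ((contDiff_trunc_jetOf hf k).differentiable (by simp) z), ContinuousLinearMap.comp_apply,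
    fderiv_trunc_jetOf hf]
  refine Eq.trans ?_ (hasDerivAt_shiftX (p := jetOf f z) hW hφ h hz).deriv.symm
  congr 1
  refine Prod.ext rfl (Prod.ext rfl ?_)
  funext i j
  simp [jetOf, TruncJet.velX, Jet.trunc, Function.iterate_succ_apply', px]

theorem py_comp_jetOf (hF : IsDifferentialFunction W F) (hW : IsOpen W) (hf : ContDiff ℝ ∞ f) :
    EqOn (py fun z => F (jetOf f z)) (fun z => ChiralType.Dy F (jetOf f z)) (f ⁻¹' W) := by
  intro z hz
  obtain ⟨k, φ, hφ, h⟩ := hF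
  have h1 : (fun z => F (jetOf f z)) =ᶠ[𝓝 z] fun z => φ ((jetOf f z).trunc k) := by
    filter_upwards [(hW.preimage hf.continuous).mem_nhds hz] with y hy using h _ hy
  have hφz : DifferentiableAt ℝ φ ((jetOf f z).trunc k) :=
    (hφ.contDiffAt ((isOpen_truncJet_over hW k).mem_nhds hz)).differentiableAt (by simp)
  rw [py, h1.fderiv_eq, fderiv_fun_comp z hφz
    ((contDiff_trunc_jetOf hf k).differentiable (by simp) z), ContinuousLinearMap.comp_apply,
    fderiv_trunc_jetOf hf]
  refine Eq.trans ?_ (hasDerivAt_shiftY (p := jetOf f z) hW hφ h hz).deriv.symm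
  congr 1
  refine Prod.ext rfl (Prod.ext rfl ?_)
  funext i j
  have := eqOn_py_iterate_px isOpen_univ (contDiff_iterate hf 0 j).contDiffOn i (mem_univ z)
  change py (px^[(i : ℕ)] (py^[(j : ℕ)] f)) z = (px^[(i : ℕ)] (py^[(j : ℕ) + 1] f)) z
  rw [Function.iterate_succ_apply']
  exact this

/-- Iterated chain rule: it turns statements about the differential consequences of the system on
the jets of a map into statements about partial derivatives of one function on the plane. -/
theorem iterate_comp_jetOf (hF : IsDifferentialFunction W F) (hW : IsOpen W)
    (hf : ContDiff ℝ ∞ f) (i j : ℕ) :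
    EqOn (px^[i] (py^[j] fun z => F (jetOf f z)))
      (fun z => (ChiralType.Dx^[i] (ChiralType.Dy^[j] F)) (jetOf f z)) (f ⁻¹' W) := by
  have hO : IsOpen (f ⁻¹' W) := hW.preimage hf.continuous
  induction i with
  | zero =>
    induction j with
    | zero => exact fun z _ => rfl
    | succ j ih =>
      simp only [Function.iterate_zero, id] at ih ⊢
      rw [Function.iterate_succ_apply', Function.iterate_succ_apply']
      exact (eqOn_py hO ih).trans ((hF.iterate_Dy hW j).py_comp_jetOf hW hf)
  | succ i ih =>
    rw [Function.iterate_succ_apply', Function.iterate_succ_apply']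
    exact (eqOn_px hO ih).trans (((hF.iterate_Dy hW j).iterate_Dx hW i).px_comp_jetOf hW hf)

end IsDifferentialFunction

end ChiralType

end

noncomputable section

namespace ChiralType

variable {n : ℕ}

/-! ### Vanishing order along the line `x + y = 0`. -/

section VanishingOrder

variable {E : Type*} [NormedAddCommGroup E] [NormedSpace ℝ E]

theorem fderiv_pow_smul (r : ℕ) {k : ℝ × ℝ → E} (hk : ContDiff ℝ ∞ k) (z v : ℝ × ℝ) :
    fderiv ℝ (fun z : ℝ × ℝ => (z.1 + z.2) ^ (r + 1) • k z) z v =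
      (z.1 + z.2) ^ r • ((z.1 + z.2) • fderiv ℝ k z v + ((r + 1 : ℝ) * (v.1 + v.2)) • k z) := by
  have h1 : HasFDerivAt (fun z : ℝ × ℝ => z.1 + z.2)
      (ContinuousLinearMap.fst ℝ ℝ ℝ + ContinuousLinearMap.snd ℝ ℝ ℝ) z :=
    hasFDerivAt_fst.add hasFDerivAt_snd
  have h2 := (h1.pow (r + 1)).fun_smul ((hk.differentiable (by simp) z).hasFDerivAt)
  rw [h2.fderiv]
  simp only [add_apply, smul_apply,
    ContinuousLinearMap.smulRight_apply, ContinuousLinearMap.coe_fst', ContinuousLinearMap.coe_snd',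
    smul_add, smul_smul, smul_eq_mul]
  congr 1
  congr 1
  simp
  ring

theorem exists_px_pow_smul (r : ℕ) {k : ℝ × ℝ → E} (hk : ContDiff ℝ ∞ k) :
    ∃ k' : ℝ × ℝ → E, ContDiff ℝ ∞ k' ∧
      px (fun z : ℝ × ℝ => (z.1 + z.2) ^ (r + 1) • k z) = (fun z => (z.1 + z.2) ^ r • k' z) ∧
      ∀ z : ℝ × ℝ, z.1 + z.2 = 0 → k' z = (r + 1 : ℝ) • k z := by
  refine ⟨fun z => (z.1 + z.2) • fderiv ℝ k z (1, 0) + (r + 1 : ℝ) • k z, ?_, ?_, ?_⟩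
  · have := contDiffOn_univ.1 (ContDiffOn.px isOpen_univ hk.contDiffOn)
    exact (ContDiff.smul (by fun_prop) this).add (hk.const_smul _)
  · funext z
    rw [px, fderiv_pow_smul r hk]
    simp
  · intro z hz
    simp [hz]

theorem exists_py_pow_smul (r : ℕ) {k : ℝ × ℝ → E} (hk : ContDiff ℝ ∞ k) :
    ∃ k' : ℝ × ℝ → E, ContDiff ℝ ∞ k' ∧
      py (fun z : ℝ × ℝ => (z.1 + z.2) ^ (r + 1) • k z) = (fun z => (z.1 + z.2) ^ r • k' z) ∧
      ∀ z : ℝ × ℝ, z.1 + z.2 = 0 → k' z = (r + 1 : ℝ) • k z := by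
  refine ⟨fun z => (z.1 + z.2) • fderiv ℝ k z (0, 1) + (r + 1 : ℝ) • k z, ?_, ?_, ?_⟩
  · have := contDiffOn_univ.1 (ContDiffOn.py isOpen_univ hk.contDiffOn)
    exact (ContDiff.smul (by fun_prop) this).add (hk.const_smul _)
  · funext z
    rw [py, fderiv_pow_smul r hk]
    simp
  · intro z hz
    simp [hz]

/-- Both partial derivatives of `x + y` equal `1`, so on the line only the number `i + j` of
derivatives matters. The spare exponent `r` carries the induction, and factorials on both sides
avoid division. -/
theorem exists_iterate_pow_smul (i j r : ℕ) {k : ℝ × ℝ → E} (hk : ContDiff ℝ ∞ k) :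
    ∃ k' : ℝ × ℝ → E, ContDiff ℝ ∞ k' ∧
      px^[i] (py^[j] (fun z : ℝ × ℝ => (z.1 + z.2) ^ (r + i + j) • k z)) =
        (fun z => (z.1 + z.2) ^ r • k' z) ∧
      ∀ z : ℝ × ℝ, z.1 + z.2 = 0 →
        (r.factorial : ℝ) • k' z = ((r + i + j).factorial : ℝ) • k z := by
  induction i generalizing r with
  | zero =>
    induction j generalizing r with
    | zero => exact ⟨k, hk, rfl, fun z _ => rfl⟩
    | succ j ih =>
      obtain ⟨k₁, hk₁, h₁, h₁'⟩ := ih (r + 1)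
      obtain ⟨k₂, hk₂, h₂, h₂'⟩ := exists_py_pow_smul r hk₁
      refine ⟨k₂, hk₂, ?_, fun z hz => ?_⟩
      · simp only [Function.iterate_zero, id] at h₁ ⊢
        rw [Function.iterate_succ_apply', show r + 0 + (j + 1) = r + 1 + 0 + j by omega, h₁, h₂]
      · rw [show r + 0 + (j + 1) = r + 1 + 0 + j by omega, ← h₁' z hz, h₂' z hz, smul_smul,
          Nat.factorial_succ]
        push_cast
        ring_nf
  | succ i ih =>
    obtain ⟨k₁, hk₁, h₁, h₁'⟩ := ih (r + 1)
    obtain ⟨k₂, hk₂, h₂, h₂'⟩ := exists_px_pow_smul r hk₁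
    refine ⟨k₂, hk₂, ?_, fun z hz => ?_⟩
    · rw [Function.iterate_succ_apply', show r + (i + 1) + j = r + 1 + i + j by omega, h₁, h₂]
    · rw [show r + (i + 1) + j = r + 1 + i + j by omega, ← h₁' z hz, h₂' z hz, smul_smul,
        Nat.factorial_succ]
      push_cast
      ring_nf

theorem iterate_pow_smul_eq_zero {i j r : ℕ} (hr : i + j < r) {k : ℝ × ℝ → E}
    (hk : ContDiff ℝ ∞ k) {z : ℝ × ℝ} (hz : z.1 + z.2 = 0) :
    (px^[i] (py^[j] (fun z : ℝ × ℝ => (z.1 + z.2) ^ r • k z))) z = 0 := by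
  obtain ⟨s, rfl⟩ := Nat.exists_eq_add_of_lt hr
  obtain ⟨k', -, h, -⟩ := exists_iterate_pow_smul i j (s + 1) hk
  rw [show i + j + s + 1 = s + 1 + i + j by omega, h]
  simp [hz]

theorem iterate_pow_smul_eq_factorial (i j : ℕ) {k : ℝ × ℝ → E}
    (hk : ContDiff ℝ ∞ k) {z : ℝ × ℝ} (hz : z.1 + z.2 = 0) :
    (px^[i] (py^[j] (fun z : ℝ × ℝ => (z.1 + z.2) ^ (i + j) • k z))) z =
      ((i + j).factorial : ℝ) • k z := by
  obtain ⟨k', -, h, h'⟩ := exists_iterate_pow_smul i j 0 hk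
  rw [zero_add] at h h'
  rw [h]
  simpa using h' z hz

end VanishingOrder

theorem iterate_sub {f g : ℝ × ℝ → Fin n → ℝ} (hf : ContDiff ℝ ∞ f) (hg : ContDiff ℝ ∞ g)
    (i j : ℕ) : px^[i] (py^[j] (fun z => f z - g z)) =
      fun z => (px^[i] (py^[j] f)) z - (px^[i] (py^[j] g)) z := by
  have hd : ∀ {h : ℝ × ℝ → Fin n → ℝ}, ContDiff ℝ ∞ h → Differentiable ℝ h :=
    fun hh => hh.differentiable (by simp)
  induction i with
  | zero =>
    induction j with
    | zero => rfl
    | succ j ih =>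
      simp only [Function.iterate_zero, id] at ih ⊢
      rw [Function.iterate_succ_apply', Function.iterate_succ_apply',
        Function.iterate_succ_apply', ih]
      funext z
      rw [py, fderiv_fun_sub (f := py^[j] f) (g := py^[j] g)
        (hd (contDiff_iterate hf 0 j) z) (hd (contDiff_iterate hg 0 j) z)]
      rfl
  | succ i ih =>
    rw [Function.iterate_succ_apply', Function.iterate_succ_apply',
      Function.iterate_succ_apply', ih]
    funext z
    rw [px, fderiv_fun_sub (hd (contDiff_iterate hf i j) z) (hd (contDiff_iterate hg i j) z)]
    rfl

theorem contDiff_pow_smul (r : ℕ) {k : ℝ × ℝ → Fin n → ℝ} (hk : ContDiff ℝ ∞ k) :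
    ContDiff ℝ ∞ fun z : ℝ × ℝ => (z.1 + z.2) ^ r • k z :=
  ((contDiff_fst.add contDiff_snd).pow r).smul hk

theorem iterate_sub_pow_smul_of_lt {f k : ℝ × ℝ → Fin n → ℝ} (hf : ContDiff ℝ ∞ f)
    (hk : ContDiff ℝ ∞ k) {i j r : ℕ} (hr : i + j < r) (x : ℝ) :
    (px^[i] (py^[j] (fun z : ℝ × ℝ => f z - (z.1 + z.2) ^ r • k z))) (x, -x) =
      (px^[i] (py^[j] f)) (x, -x) := by
  rw [iterate_sub hf (contDiff_pow_smul r hk)]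
  beta_reduce
  rw [iterate_pow_smul_eq_zero hr hk (by simp), sub_zero]

theorem iterate_sub_pow_smul_of_eq {f k : ℝ × ℝ → Fin n → ℝ} (hf : ContDiff ℝ ∞ f)
    (hk : ContDiff ℝ ∞ k) {i j r : ℕ} (hr : i + j = r) (x : ℝ) :
    (px^[i] (py^[j] (fun z : ℝ × ℝ => f z - (z.1 + z.2) ^ r • k z))) (x, -x) =
      (px^[i] (py^[j] f)) (x, -x) - (r.factorial : ℝ) • k (x, -x) := by
  subst hr
  rw [iterate_sub hf (contDiff_pow_smul _ hk)]
  beta_reduce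
  rw [iterate_pow_smul_eq_factorial i j hk (by simp)]

theorem jetOf_eq_of_eqOn {f g : ℝ × ℝ → Fin n → ℝ} {O : Set (ℝ × ℝ)} (hO : IsOpen O)
    (h : EqOn f g O) {z : ℝ × ℝ} (hz : z ∈ O) : jetOf f z = jetOf g z := by
  have : (fun i j => (px^[i] (py^[j] f)) z) = fun i j => (px^[i] (py^[j] g)) z := by
    funext i j
    exact eqOn_iterate_px hO (eqOn_iterate_py hO h j) i hz
  simp only [jetOf, this]

/-- If all `∂_y^j h`, `j < m`, vanish on the line `x + y = 0`, then so do all derivatives of total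
order less than `m`. -/
theorem iterate_eq_zero_on_line {h : ℝ × ℝ → ℝ} {O : Set (ℝ × ℝ)} (hO : IsOpen O)
    (hh : ContDiffOn ℝ ∞ h O) (hline : ∀ x : ℝ, (x, -x) ∈ O) {m : ℕ}
    (h0 : ∀ j < m, ∀ x : ℝ, (py^[j] h) (x, -x) = 0) (i : ℕ) :
    ∀ j, i + j < m → ∀ x : ℝ, (px^[i] (py^[j] h)) (x, -x) = 0 := by
  induction i with
  | zero => intro j hj x; exact h0 j (by omega) x
  | succ i ih =>
    intro j hj x
    have hk : ContDiffOn ℝ ∞ (px^[i] (py^[j] h)) O :=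
      ContDiffOn.iterate_px hO (ContDiffOn.iterate_py hO hh j) i
    have hd : HasFDerivAt (px^[i] (py^[j] h)) (fderiv ℝ (px^[i] (py^[j] h)) (x, -x)) (x, -x) :=
      ((hk.contDiffAt (hO.mem_nhds (hline x))).differentiableAt (by simp)).hasFDerivAt
    have hl : HasDerivAt (fun x : ℝ => (x, -x)) (1, -1) x :=
      (hasDerivAt_id x).prodMk (hasDerivAt_id x).neg
    have h1 := hd.comp_hasDerivAt x hl
    have h2 : (px^[i] (py^[j] h)) ∘ (fun x : ℝ => (x, -x)) = fun _ => 0 := by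
      funext x; exact ih j (by omega) x
    rw [h2] at h1
    have h3 := h1.unique (hasDerivAt_const x (0 : ℝ))
    have h4 : py (px^[i] (py^[j] h)) (x, -x) = 0 := by
      rw [eqOn_py_iterate_px hO (ContDiffOn.iterate_py hO hh j) i (hline x),
        ← Function.iterate_succ_apply' py]
      exact ih (j + 1) (by omega) x
    rw [Function.iterate_succ_apply']
    -- The line is transversal to `∂_y`: `∂_x` is the tangential derivative, zero because the
    -- function vanishes on the line, plus `∂_y`.
    have h5 : ((1, 0) : ℝ × ℝ) = (1, -1) + (0, 1) := by simp
    rw [px, h5, map_add, h3, zero_add]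
    exact h4

/-! ### Formal solutions with Cauchy data on the line. -/

section Sections

variable (G : Fin n → Fin n → Fin n → (Fin n → ℝ) → ℝ) (Q : Fin n → (Fin n → ℝ) → ℝ)

/-- Maps which solve the system to higher and higher order along the line `x + y = 0`, with
Cauchy data `f = u₀`, `f_y = b`. -/
def approxSolution (u₀ : Fin n → ℝ) (b : ℝ → Fin n → ℝ) : ℕ → ℝ × ℝ → Fin n → ℝ
  | 0 => fun z => u₀ + (z.1 + z.2) • b z.1
  -- On the line, `(x + y)^(m+2) / (m+2)!` times a function of `x` leaves derivatives of order at
  -- most `m + 1` unchanged and shifts `U_{1,m+1}`, the leading term of `D_y^m Δ`, by exactly that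
  -- function; subtracting the residual therefore cancels it.
  | m + 1 => fun z => approxSolution u₀ b m z - (z.1 + z.2) ^ (m + 2) •
      (((m + 2).factorial : ℝ)⁻¹ • fun α =>
        (Dy^[m] (chiralDelta G Q α)) (jetOf (approxSolution u₀ b m) (z.1, -z.1)))

variable {G Q} {W : Set (Fin n → ℝ)} {u₀ : Fin n → ℝ} {b : ℝ → Fin n → ℝ}

theorem approxSolution_line (x : ℝ) (m : ℕ) : approxSolution G Q u₀ b m (x, -x) = u₀ := by
  induction m with
  | zero => simp [approxSolution]
  | succ m ih => simp [approxSolution, ih]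

theorem contDiff_residual (hW : IsOpen W) (hG : ∀ α β γ, ContDiffOn ℝ ∞ (G α β γ) W)
    (hQ : ∀ α, ContDiffOn ℝ ∞ (Q α) W) (hu₀ : u₀ ∈ W) {f : ℝ × ℝ → Fin n → ℝ}
    (hf : ContDiff ℝ ∞ f) (hfl : ∀ x : ℝ, f (x, -x) = u₀) (m : ℕ) (c : ℝ) :
    ContDiff ℝ ∞ (fun z : ℝ × ℝ => c • fun α =>
      (Dy^[m] (chiralDelta G Q α)) (jetOf f (z.1, -z.1))) := by
  refine ContDiff.const_smul c (contDiff_pi.2 fun α => ?_)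
  have h := ((isDifferentialFunction_chiralDelta hG hQ α).iterate_Dy hW m).contDiffOn_comp_jetOf hf
  refine contDiffOn_univ.1 (h.comp (g := fun z => (Dy^[m] (chiralDelta G Q α)) (jetOf f z))
    (f := fun z : ℝ × ℝ => (z.1, -z.1)) (by fun_prop) fun z _ => ?_)
  rw [mem_preimage, hfl]
  exact hu₀

theorem contDiff_approxSolution (hW : IsOpen W) (hG : ∀ α β γ, ContDiffOn ℝ ∞ (G α β γ) W)
    (hQ : ∀ α, ContDiffOn ℝ ∞ (Q α) W) (hu₀ : u₀ ∈ W) (hb : ContDiff ℝ ∞ b) (m : ℕ) :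
    ContDiff ℝ ∞ (approxSolution G Q u₀ b m) := by
  induction m with
  | zero =>
    unfold approxSolution
    fun_prop
  | succ m ih =>
    unfold approxSolution
    exact ih.sub (contDiff_pow_smul _
      (contDiff_residual hW hG hQ hu₀ ih (fun x => approxSolution_line x m) m _))

theorem agreeUpTo_approxSolution_succ (hW : IsOpen W)
    (hG : ∀ α β γ, ContDiffOn ℝ ∞ (G α β γ) W)
    (hQ : ∀ α, ContDiffOn ℝ ∞ (Q α) W) (hu₀ : u₀ ∈ W) (hb : ContDiff ℝ ∞ b) (m : ℕ) (x : ℝ) :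
    Jet.AgreeUpTo (m + 1) (jetOf (approxSolution G Q u₀ b (m + 1)) (x, -x))
      (jetOf (approxSolution G Q u₀ b m) (x, -x)) := by
  have hf := contDiff_approxSolution hW hG hQ hu₀ hb m
  have hk := contDiff_residual hW hG hQ hu₀ hf (fun x => approxSolution_line x m) m
    ((m + 2).factorial : ℝ)⁻¹
  exact ⟨rfl, rfl, fun i j hij => iterate_sub_pow_smul_of_lt hf hk (by omega) x⟩

theorem agreeUpTo_approxSolution (hW : IsOpen W)
    (hG : ∀ α β γ, ContDiffOn ℝ ∞ (G α β γ) W)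
    (hQ : ∀ α, ContDiffOn ℝ ∞ (Q α) W) (hu₀ : u₀ ∈ W) (hb : ContDiff ℝ ∞ b) {m M : ℕ}
    (hmM : m ≤ M) (x : ℝ) :
    Jet.AgreeUpTo (m + 1) (jetOf (approxSolution G Q u₀ b M) (x, -x))
      (jetOf (approxSolution G Q u₀ b m) (x, -x)) := by
  induction M, hmM using Nat.le_induction with
  | base => exact ⟨rfl, rfl, fun _ _ _ => rfl⟩
  | succ M hM ih =>
    have h := agreeUpTo_approxSolution_succ hW hG hQ hu₀ hb M x
    exact ⟨rfl, rfl, fun i j hij => (h.u_eq i j (by omega)).trans (ih.u_eq i j hij)⟩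

theorem approxSolution_residual_Dy (hW : IsOpen W)
    (hG : ∀ α β γ, ContDiffOn ℝ ∞ (G α β γ) W)
    (hQ : ∀ α, ContDiffOn ℝ ∞ (Q α) W) (hu₀ : u₀ ∈ W) (hb : ContDiff ℝ ∞ b) (m : ℕ) :
    ∀ l < m, ∀ (x : ℝ) (α : Fin n),
      (Dy^[l] (chiralDelta G Q α)) (jetOf (approxSolution G Q u₀ b m) (x, -x)) = 0 := by
  induction m with
  | zero => intro l hl; omega
  | succ m ih =>
    intro l hl x α
    have hag := agreeUpTo_approxSolution_succ hW hG hQ hu₀ hb m x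
    have hmem : (jetOf (approxSolution G Q u₀ b (m + 1)) (x, -x)).u 0 0 ∈ W := by
      change approxSolution G Q u₀ b (m + 1) (x, -x) ∈ W
      rwa [approxSolution_line]
    -- The older residuals have order at most `m + 1` and are untouched by the correction; the new
    -- one, `l = m`, is cancelled by it.
    rcases Nat.lt_succ_iff_lt_or_eq.1 hl with hlm | rfl
    · have := hasOrderLE_iterate_chiralDelta hW G Q 0 l α _ _ hmem (hag.mono (by omega))
      exact this.trans (ih l hlm x α)
    · have hf := contDiff_approxSolution hW hG hQ hu₀ hb l
      have hk := contDiff_residual hW hG hQ hu₀ hf (fun x => approxSolution_line x l) l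
        ((l + 2).factorial : ℝ)⁻¹
      have h1 := hasOrderLE_iterate_Dy_sub hW hG hQ α l _ _ hmem hag
      have h2 : (jetOf (approxSolution G Q u₀ b (l + 1)) (x, -x)).u 1 (l + 1) α =
          (jetOf (approxSolution G Q u₀ b l) (x, -x)).u 1 (l + 1) α -
            (Dy^[l] (chiralDelta G Q α)) (jetOf (approxSolution G Q u₀ b l) (x, -x)) := by
        have h3 := iterate_sub_pow_smul_of_eq hf hk (show 1 + (l + 1) = l + 2 by omega) x
        rw [smul_smul, mul_inv_cancel₀ (by positivity), one_smul] at h3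
        exact congrFun h3 α
      beta_reduce at h1
      rw [h2] at h1
      linarith

/-- The infinite jet along the line `x + y = 0` of the formal solution with Cauchy data
`f = u₀`, `f_y = b`. -/
def formalJet (G : Fin n → Fin n → Fin n → (Fin n → ℝ) → ℝ) (Q : Fin n → (Fin n → ℝ) → ℝ)
    (u₀ : Fin n → ℝ) (b : ℝ → Fin n → ℝ) (x : ℝ) : Jet n :=
  ⟨x, -x, fun i j => (jetOf (approxSolution G Q u₀ b (i + j)) (x, -x)).u i j⟩

theorem agreeUpTo_formalJet (hW : IsOpen W)
    (hG : ∀ α β γ, ContDiffOn ℝ ∞ (G α β γ) W)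
    (hQ : ∀ α, ContDiffOn ℝ ∞ (Q α) W) (hu₀ : u₀ ∈ W) (hb : ContDiff ℝ ∞ b) (m : ℕ) (x : ℝ) :
    Jet.AgreeUpTo m (jetOf (approxSolution G Q u₀ b m) (x, -x)) (formalJet G Q u₀ b x) :=
  ⟨rfl, rfl, fun i j hij =>
    (agreeUpTo_approxSolution hW hG hQ hu₀ hb hij x).u_eq i j (by omega)⟩

/-- The construction controls only the `D_y^l Δ`; since they vanish along the whole line, tangential
differentiation supplies the `D_x` derivatives. -/
theorem approxSolution_residual (hW : IsOpen W)
    (hG : ∀ α β γ, ContDiffOn ℝ ∞ (G α β γ) W)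
    (hQ : ∀ α, ContDiffOn ℝ ∞ (Q α) W) (hu₀ : u₀ ∈ W) (hb : ContDiff ℝ ∞ b) {m i j : ℕ}
    (hij : i + j < m) (x : ℝ) (α : Fin n) :
    (Dx^[i] (Dy^[j] (chiralDelta G Q α))) (jetOf (approxSolution G Q u₀ b m) (x, -x)) = 0 := by
  have hf := contDiff_approxSolution hW hG hQ hu₀ hb m
  have hF := isDifferentialFunction_chiralDelta hG hQ α
  have hline : ∀ x : ℝ, (x, -x) ∈ approxSolution G Q u₀ b m ⁻¹' W := fun x => by
    rw [mem_preimage, approxSolution_line]; exact hu₀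
  refine (hF.iterate_comp_jetOf hW hf i j (hline x)).symm.trans ?_
  refine iterate_eq_zero_on_line (hW.preimage hf.continuous) (hF.contDiffOn_comp_jetOf hf) hline
    (fun l hl x => ?_) i j hij x
  exact (hF.iterate_comp_jetOf hW hf 0 l (hline x)).trans
    (approxSolution_residual_Dy hW hG hQ hu₀ hb m l hl x α)

theorem onEquation_formalJet (hW : IsOpen W)
    (hG : ∀ α β γ, ContDiffOn ℝ ∞ (G α β γ) W)
    (hQ : ∀ α, ContDiffOn ℝ ∞ (Q α) W) (hu₀ : u₀ ∈ W) (hb : ContDiff ℝ ∞ b) (x : ℝ) :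
    OnEquation G Q (formalJet G Q u₀ b x) := by
  intro i j α
  -- The index `i + j + 2` is the order of `D_x^i D_y^j Δ`, so at this stage the approximation
  -- already has the formal jet's relevant coordinates.
  rw [← approxSolution_residual hW hG hQ hu₀ hb (show i + j < i + j + 2 by omega) x α]
  refine (hasOrderLE_iterate_chiralDelta hW G Q i j α _ _ ?_
    (agreeUpTo_formalJet hW hG hQ hu₀ hb _ x)).symm
  change approxSolution G Q u₀ b _ (x, -x) ∈ W
  rwa [approxSolution_line]

/-- A differential function of order at most `m` cannot distinguish the `m`-th approximation from
the formal solution, whose jets satisfy the system with all its consequences. -/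
theorem eq_zero_of_vanishing_on_equation (hW : IsOpen W)
    (hG : ∀ α β γ, ContDiffOn ℝ ∞ (G α β γ) W)
    (hQ : ∀ α, ContDiffOn ℝ ∞ (Q α) W) (hu₀ : u₀ ∈ W) (hb : ContDiff ℝ ∞ b) {P : Jet n → ℝ}
    {r m : ℕ} (hrm : r ≤ m) (hr : HasOrderLE W r P)
    (hP : ∀ p : Jet n, p.u 0 0 ∈ W → OnEquation G Q p → P p = 0) (x : ℝ) :
    P (jetOf (approxSolution G Q u₀ b m) (x, -x)) = 0 := by
  have hag := agreeUpTo_formalJet hW hG hQ hu₀ hb m x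
  have hmem : (jetOf (approxSolution G Q u₀ b m) (x, -x)).u 0 0 ∈ W := by
    change approxSolution G Q u₀ b _ (x, -x) ∈ W
    rwa [approxSolution_line]
  rw [hr _ _ hmem (hag.mono hrm)]
  refine hP _ ?_ (onEquation_formalJet hW hG hQ hu₀ hb x)
  rwa [← hag.u_eq 0 0 (Nat.zero_le _)]

/-- Every correction at `(x, y)` uses only data near `x`; compactly supported `b` thus changes
nothing near the vertical sides of the parallelogram. -/
theorem approxSolution_eqOn {b' : ℝ → Fin n → ℝ} {I : Set ℝ} (hI : IsOpen I) (hbb : EqOn b b' I)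
    (m : ℕ) : EqOn (approxSolution G Q u₀ b m) (approxSolution G Q u₀ b' m) (Prod.fst ⁻¹' I) := by
  induction m with
  | zero => intro z hz; simp only [approxSolution, hbb hz]
  | succ m ih =>
    intro z hz
    simp only [approxSolution]
    rw [ih hz, jetOf_eq_of_eqOn (hI.preimage continuous_fst) ih
      (show (z.1, -z.1) ∈ Prod.fst ⁻¹' I from hz)]

/-- The first derivatives are fixed by the initial stage `u₀ + (x + y) b(x)`, since corrections
begin at order two. -/
theorem jetOf_approxSolution_line (hW : IsOpen W)
    (hG : ∀ α β γ, ContDiffOn ℝ ∞ (G α β γ) W)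
    (hQ : ∀ α, ContDiffOn ℝ ∞ (Q α) W) (hu₀ : u₀ ∈ W) (hb : ContDiff ℝ ∞ b) (m : ℕ) (x : ℝ) :
    (jetOf (approxSolution G Q u₀ b m) (x, -x)).u 1 0 = b x ∧
    (jetOf (approxSolution G Q u₀ b m) (x, -x)).u 0 1 = b x := by
  have hag := agreeUpTo_approxSolution hW hG hQ hu₀ hb (Nat.zero_le m) x
  have hk : ContDiff ℝ ∞ fun z : ℝ × ℝ => -b z.1 := by fun_prop
  have hc : ContDiff ℝ ∞ fun _ : ℝ × ℝ => u₀ := contDiff_const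
  have h0 : approxSolution G Q u₀ b 0 = fun z => u₀ - (z.1 + z.2) ^ 1 • (-b z.1) := by
    funext z; simp [approxSolution]
  have hz : ∀ i j, i + j = 1 → (px^[i] (py^[j] fun _ : ℝ × ℝ => u₀)) = fun _ => 0 := by
    intro i j hij
    obtain ⟨rfl, rfl⟩ | ⟨rfl, rfl⟩ : (i = 1 ∧ j = 0) ∨ (i = 0 ∧ j = 1) := by omega
    · funext z; simp [px]
    · funext z; simp [py]
  have key : ∀ i j, i + j = 1 → (jetOf (approxSolution G Q u₀ b m) (x, -x)).u i j = b x := by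
    intro i j hij
    rw [hag.u_eq i j (by omega)]
    change (px^[i] (py^[j] (approxSolution G Q u₀ b 0))) (x, -x) = _
    rw [h0, iterate_sub_pow_smul_of_eq hc hk hij, hz i j hij]
    simp
  exact ⟨key 1 0 rfl, key 0 1 rfl⟩

end Sections

end ChiralType

end

/-! ### Flux through the line and nontriviality. -/

noncomputable section

namespace ChiralType

variable {n : ℕ}

/-- The flux of a pair with identically vanishing divergence out of the parallelogram
`|x| ≤ 1`, `0 ≤ x + y ≤ τ` is zero. -/
theorem flux_eq_zero {W : Set (Fin n → ℝ)} (hW : IsOpen W) {T₁ T₂ : Jet n → ℝ}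
    (h₁ : IsDifferentialFunction W T₁) (h₂ : IsDifferentialFunction W T₂)
    (hdiv : ∀ p : Jet n, p.u 0 0 ∈ W → Dx T₁ p + Dy T₂ p = 0) {f : ℝ × ℝ → Fin n → ℝ}
    (hf : ContDiff ℝ ∞ f) {τ : ℝ} (hτ : 0 ≤ τ)
    (hfW : ∀ x ∈ Icc (-1 : ℝ) 1, ∀ t ∈ Icc 0 τ, f (x, t - x) ∈ W) :
    (∫ x in (-1 : ℝ)..1, (T₁ (jetOf f (x, -x)) + T₂ (jetOf f (x, -x)))) =
      (∫ x in (-1 : ℝ)..1, (T₁ (jetOf f (x, τ - x)) + T₂ (jetOf f (x, τ - x)))) +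
        (∫ t in (0 : ℝ)..τ, T₁ (jetOf f (1, t - 1))) -
          ∫ t in (0 : ℝ)..τ, T₁ (jetOf f (-1, t + 1)) := by
  -- A shear carrying the rectangle to the parallelogram. In the coordinates `(x, t)`, `t = x + y`,
  -- the pair `(T₁, T₁ + T₂)` has divergence `∂_x T₁ + ∂_y T₂`, so the divergence theorem on
  -- rectangles applies.
  set ψ : ℝ × ℝ →L[ℝ] ℝ × ℝ := (ContinuousLinearMap.fst ℝ ℝ ℝ).prod
    (ContinuousLinearMap.snd ℝ ℝ ℝ - ContinuousLinearMap.fst ℝ ℝ ℝ) with hψ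
  have hψv : ∀ x t : ℝ, ψ (x, t) = (x, t - x) := fun x t => rfl
  have hO : IsOpen (f ⁻¹' W) := hW.preimage hf.continuous
  have hmem : ∀ z ∈ [[(-1 : ℝ), 1]] ×ˢ [[0, τ]], ψ z ∈ f ⁻¹' W := by
    rintro ⟨x, t⟩ ⟨hx, ht⟩
    rw [uIcc_of_le (by norm_num)] at hx
    rw [uIcc_of_le hτ] at ht
    exact hfW x hx t ht
  have hsub : ∀ z ∈ Ioo (min (-1 : ℝ) 1) (max (-1 : ℝ) 1) ×ˢ Ioo (min 0 τ) (max 0 τ),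
      z ∈ [[(-1 : ℝ), 1]] ×ˢ [[0, τ]] := fun z hz =>
    ⟨Ioo_subset_Icc_self hz.1, Ioo_subset_Icc_self hz.2⟩
  have hc : ∀ {F : Jet n → ℝ}, IsDifferentialFunction W F →
      ContinuousOn (fun z => F (jetOf f (ψ z))) ([[(-1 : ℝ), 1]] ×ˢ [[0, τ]]) := fun hF =>
    (hF.contDiffOn_comp_jetOf hf).continuousOn.comp ψ.continuous.continuousOn hmem
  have hd : ∀ {F : Jet n → ℝ}, IsDifferentialFunction W F → ∀ z, ψ z ∈ f ⁻¹' W →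
      HasFDerivAt (fun z => F (jetOf f (ψ z)))
        ((fderiv ℝ (fun z => F (jetOf f z)) (ψ z)).comp ψ) z := fun hF z hz =>
    ((((hF.contDiffOn_comp_jetOf hf).contDiffAt (hO.mem_nhds hz)).differentiableAt
      (by simp)).hasFDerivAt).comp z ψ.hasFDerivAt
  have hzero : ∀ z, ψ z ∈ f ⁻¹' W →
      ((fderiv ℝ (fun z => T₁ (jetOf f z)) (ψ z)).comp ψ) (1, 0) +
      ((fderiv ℝ (fun z => T₁ (jetOf f z)) (ψ z)).comp ψ +
        (fderiv ℝ (fun z => T₂ (jetOf f z)) (ψ z)).comp ψ) (0, 1) = 0 := by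
    intro z hz
    have e1 := h₁.px_comp_jetOf hW hf hz
    have e2 := h₂.py_comp_jetOf hW hf hz
    have e3 := hdiv (jetOf f (ψ z)) hz
    beta_reduce at e1 e2
    rw [← e1, ← e2, px, py] at e3
    rw [add_apply, ContinuousLinearMap.comp_apply, ContinuousLinearMap.comp_apply,
      ContinuousLinearMap.comp_apply, ← add_assoc, ← map_add,
      show ψ (1, 0) + ψ (0, 1) = (1, 0) by rw [hψv, hψv]; simp,
      show ψ (0, 1) = (0, 1) by rw [hψv]; simp]
    exact e3
  have hzero' : EqOn (fun z => ((fderiv ℝ (fun z => T₁ (jetOf f z)) (ψ z)).comp ψ) (1, 0) +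
      ((fderiv ℝ (fun z => T₁ (jetOf f z)) (ψ z)).comp ψ +
        (fderiv ℝ (fun z => T₂ (jetOf f z)) (ψ z)).comp ψ) (0, 1)) (fun _ => 0)
      ([[(-1 : ℝ), 1]] ×ˢ [[0, τ]]) := fun z hz => hzero z (hmem z hz)
  have key := integral2_divergence_prod_of_hasFDerivAt (E := ℝ)
    (fun z => T₁ (jetOf f (ψ z))) (fun z => T₁ (jetOf f (ψ z)) + T₂ (jetOf f (ψ z)))
    (fun z => (fderiv ℝ (fun z => T₁ (jetOf f z)) (ψ z)).comp ψ)
    (fun z => (fderiv ℝ (fun z => T₁ (jetOf f z)) (ψ z)).comp ψ +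
      (fderiv ℝ (fun z => T₂ (jetOf f z)) (ψ z)).comp ψ) (-1) 0 1 τ (hc h₁)
    ((hc h₁).add (hc h₂)) (fun z hz => hd h₁ z (hmem z (hsub z hz)))
    (fun z hz => (hd h₁ z (hmem z (hsub z hz))).add (hd h₂ z (hmem z (hsub z hz))))
    (integrableOn_zero.congr_fun hzero'.symm (measurableSet_uIcc.prod measurableSet_uIcc))
  have hleft : (∫ x in (-1 : ℝ)..1, ∫ t in (0 : ℝ)..τ,
      (((fderiv ℝ (fun z => T₁ (jetOf f z)) (ψ (x, t))).comp ψ) (1, 0) +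
      ((fderiv ℝ (fun z => T₁ (jetOf f z)) (ψ (x, t))).comp ψ +
        (fderiv ℝ (fun z => T₂ (jetOf f z)) (ψ (x, t))).comp ψ) (0, 1))) = 0 := by
    rw [intervalIntegral.integral_congr (g := fun _ => (0 : ℝ)), intervalIntegral.integral_zero]
    intro x hx
    beta_reduce
    rw [intervalIntegral.integral_congr (g := fun _ => (0 : ℝ)), intervalIntegral.integral_zero]
    intro t ht
    exact hzero' (⟨hx, ht⟩ : (x, t) ∈ _ ×ˢ _)
  rw [hleft] at key
  simp only [hψv, zero_sub, sub_neg_eq_add] at key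
  linarith

/-- Two maps with the same jets on the top and on the sides of the parallelogram have the same flux
through its bottom. -/
theorem bottom_flux_eq {W : Set (Fin n → ℝ)} (hW : IsOpen W) {T₁ T₂ : Jet n → ℝ}
    (h₁ : IsDifferentialFunction W T₁) (h₂ : IsDifferentialFunction W T₂)
    (hdiv : ∀ p : Jet n, p.u 0 0 ∈ W → Dx T₁ p + Dy T₂ p = 0) {f g : ℝ × ℝ → Fin n → ℝ}
    (hf : ContDiff ℝ ∞ f) (hg : ContDiff ℝ ∞ g) {τ : ℝ} (hτ : 0 ≤ τ)
    (hfW : ∀ x ∈ Icc (-1 : ℝ) 1, ∀ t ∈ Icc 0 τ, f (x, t - x) ∈ W)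
    (hgW : ∀ x ∈ Icc (-1 : ℝ) 1, ∀ t ∈ Icc 0 τ, g (x, t - x) ∈ W)
    (htop : ∀ x, jetOf f (x, τ - x) = jetOf g (x, τ - x))
    (hright : ∀ t, jetOf f (1, t) = jetOf g (1, t))
    (hleft : ∀ t, jetOf f (-1, t) = jetOf g (-1, t)) :
    (∫ x in (-1 : ℝ)..1, (T₁ (jetOf f (x, -x)) + T₂ (jetOf f (x, -x)))) =
      ∫ x in (-1 : ℝ)..1, (T₁ (jetOf g (x, -x)) + T₂ (jetOf g (x, -x))) := by
  rw [flux_eq_zero hW h₁ h₂ hdiv hf hτ hfW, flux_eq_zero hW h₁ h₂ hdiv hg hτ hgW]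
  simp only [htop, hright, hleft]

/-- Maps equal to `u₀` on the line `x + y = 0` stay close to `u₀` on a thin parallelogram. -/
theorem exists_height {u₀ : Fin n → ℝ} {B : Set (Fin n → ℝ)} (hB : B ∈ 𝓝 u₀)
    {f : ℝ × ℝ → Fin n → ℝ} (hf : Continuous f) (hfl : ∀ x : ℝ, f (x, -x) = u₀) :
    ∃ τ > 0, ∀ x ∈ Icc (-1 : ℝ) 1, ∀ t ∈ Icc 0 τ, f (x, t - x) ∈ B := by
  obtain ⟨B', hB', hBo, hu⟩ := mem_nhds_iff.1 hB
  obtain ⟨U, V, hU, hV, hIU, h0V, hUV⟩ := generalized_tube_lemma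
    (isCompact_Icc (a := (-1 : ℝ)) (b := 1)) (isCompact_singleton (x := (0 : ℝ)))
    (hBo.preimage (f := fun z : ℝ × ℝ => f (z.1, z.2 - z.1)) (by fun_prop)) (by
      rintro ⟨x, t⟩ ⟨-, ht⟩
      obtain rfl : t = 0 := ht
      simpa [hfl] using hu)
  obtain ⟨ε, hε, hεV⟩ := Metric.isOpen_iff.1 hV 0 (h0V rfl)
  refine ⟨ε / 2, by positivity, fun x hx t ht => hB' ?_⟩
  refine hUV (⟨hIU hx, hεV ?_⟩ : (x, t) ∈ U ×ˢ V)
  rw [Metric.mem_ball, Real.dist_eq, sub_zero, abs_of_nonneg ht.1]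
  linarith [ht.2]

/-- On the line the Cauchy data satisfy `U_x = U_y`, so `Ω` cancels from `L₁ + L₂` and the flux sees
only `R(u₀)`. A trivial law would have the same flux for the data `b` and for the data `0`. -/
theorem not_isTrivialLaw {W : Set (Fin n → ℝ)} (hW : IsOpen W)
    {G : Fin n → Fin n → Fin n → (Fin n → ℝ) → ℝ} {Q : Fin n → (Fin n → ℝ) → ℝ}
    (hG : ∀ α β γ, ContDiffOn ℝ ∞ (G α β γ) W) (hQ : ∀ α, ContDiffOn ℝ ∞ (Q α) W)
    {R Ω : Fin n → (Fin n → ℝ) → ℝ} (hR : ∃ u ∈ W, ∃ α, R α u ≠ 0) :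
    ¬ IsTrivialLaw W G Q (fun p => ∑ α, (R α (p.u 0 0) - Ω α (p.u 0 0)) * p.u 0 1 α)
      (fun p => ∑ α, Ω α (p.u 0 0) * p.u 1 0 α) := by
  rintro ⟨P₁, P₂, T₁, T₂, hP₁, hP₂, hT₁, hT₂, hL, hP, hT⟩
  obtain ⟨u₀, hu₀, α₀, hα₀⟩ := hR
  obtain ⟨r₁, hr₁⟩ := hP₁.exists_hasOrderLE
  obtain ⟨r₂, hr₂⟩ := hP₂.exists_hasOrderLE
  set m := max r₁ r₂ with hm
  -- The support in `|x| ≤ 1/2` stays away from the sides `x = ±1`; the direction `R(u₀)` makes the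
  -- flux density a positive multiple of `χ`.
  let χ : ContDiffBump (0 : ℝ) := ⟨1 / 4, 1 / 2, by norm_num, by norm_num⟩
  set b : ℝ → Fin n → ℝ := fun x => χ x • fun α => R α u₀ with hb
  have hbs : ContDiff ℝ ∞ b := χ.contDiff.smul contDiff_const
  have h0s : ContDiff ℝ ∞ (fun _ : ℝ => (0 : Fin n → ℝ)) := contDiff_const
  set f := approxSolution G Q u₀ b m with hf
  set g := approxSolution G Q u₀ (fun _ => 0) m with hg
  have hfs : ContDiff ℝ ∞ f := contDiff_approxSolution hW hG hQ hu₀ hbs m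
  have hgs : ContDiff ℝ ∞ g := contDiff_approxSolution hW hG hQ hu₀ h0s m
  -- A ball is convex, so the interpolation between `f` and `g` below does not leave `W`.
  obtain ⟨ε, hε, hεW⟩ := Metric.isOpen_iff.1 hW u₀ hu₀
  obtain ⟨τ₁, hτ₁, hτf⟩ := exists_height (Metric.ball_mem_nhds u₀ hε) hfs.continuous
    (fun x => approxSolution_line x m)
  obtain ⟨τ₂, hτ₂, hτg⟩ := exists_height (Metric.ball_mem_nhds u₀ hε) hgs.continuous
    (fun x => approxSolution_line x m)
  set τ := min τ₁ τ₂ with hτ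
  have hτpos : 0 < τ := lt_min hτ₁ hτ₂
  let η : ContDiffBump (0 : ℝ) := ⟨τ / 4, τ / 2, by positivity, by linarith⟩
  -- `V` agrees with `f` near the bottom, with `g` near the top by the cutoff `η`, and with `g` near
  -- the sides because `f = g` there.
  set V : ℝ × ℝ → Fin n → ℝ := fun z => g z + η (z.1 + z.2) • (f z - g z) with hV
  have hVs : ContDiff ℝ ∞ V :=
    hgs.add ((η.contDiff.comp (contDiff_fst.add contDiff_snd)).smul (hfs.sub hgs))
  have hgW : ∀ x ∈ Icc (-1 : ℝ) 1, ∀ t ∈ Icc 0 τ, g (x, t - x) ∈ W := fun x hx t ht =>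
    hεW (hτg x hx t ⟨ht.1, ht.2.trans (min_le_right _ _)⟩)
  have hVW : ∀ x ∈ Icc (-1 : ℝ) 1, ∀ t ∈ Icc 0 τ, V (x, t - x) ∈ W := fun x hx t ht =>
    hεW ((convex_ball u₀ ε).add_smul_sub_mem
      (hτg x hx t ⟨ht.1, ht.2.trans (min_le_right _ _)⟩)
      (hτf x hx t ⟨ht.1, ht.2.trans (min_le_left _ _)⟩) ⟨η.nonneg, η.le_one⟩)
  have hI : IsOpen {x : ℝ | 1 / 2 < |x|} := isOpen_lt continuous_const continuous_abs
  have hVside : EqOn V g (Prod.fst ⁻¹' {x : ℝ | 1 / 2 < |x|}) := by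
    have hfg : EqOn f g (Prod.fst ⁻¹' {x : ℝ | 1 / 2 < |x|}) :=
      approxSolution_eqOn hI (fun x hx => by
        have : χ x = 0 := χ.zero_of_le_dist (by
          rw [Real.dist_eq, sub_zero]; exact le_of_lt hx)
        simp [hb, this]) m
    intro z hz
    simp [hV, hfg hz]
  have hside : ∀ z : ℝ × ℝ, 1 / 2 < |z.1| → jetOf V z = jetOf g z := fun z hz =>
    jetOf_eq_of_eqOn (hI.preimage continuous_fst) hVside hz
  have htop : ∀ x : ℝ, jetOf V (x, τ - x) = jetOf g (x, τ - x) := by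
    intro x
    refine jetOf_eq_of_eqOn (O := {z : ℝ × ℝ | τ / 2 < z.1 + z.2})
      (isOpen_lt continuous_const (by fun_prop)) (fun z hz => ?_) ?_
    · have : η (z.1 + z.2) = 0 := η.zero_of_le_dist (by
        rw [Real.dist_eq, sub_zero]; exact (le_of_lt hz).trans (le_abs_self _))
      simp [hV, this]
    · simp only [mem_ofPred_eq]; linarith
  have hbot : ∀ x : ℝ, jetOf V (x, -x) = jetOf f (x, -x) := by
    intro x
    refine jetOf_eq_of_eqOn (O := {z : ℝ × ℝ | |z.1 + z.2| < τ / 4})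
      (isOpen_lt (by fun_prop) continuous_const) (fun z hz => ?_) ?_
    · have : η (z.1 + z.2) = 1 := η.one_of_mem_closedBall (by
        rw [Metric.mem_closedBall, Real.dist_eq, sub_zero]; exact le_of_lt hz)
      simp [hV, this]
    · simp only [mem_ofPred_eq, add_neg_cancel, abs_zero]; positivity
  have hflux := bottom_flux_eq hW hT₁ hT₂ hT hVs hgs hτpos.le hVW hgW htop
    (fun t => hside _ (by norm_num)) (fun t => hside _ (by norm_num))
  -- The pair `P` vanishes on these jets, so the divergence-free pair carries the whole flux density
  -- of the law.
  have hval : ∀ {c : ℝ → Fin n → ℝ}, ContDiff ℝ ∞ c → ∀ x : ℝ,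
      T₁ (jetOf (approxSolution G Q u₀ c m) (x, -x)) +
        T₂ (jetOf (approxSolution G Q u₀ c m) (x, -x)) = ∑ α, R α u₀ * c x α := by
    intro c hc x
    have hmem : (jetOf (approxSolution G Q u₀ c m) (x, -x)).u 0 0 = u₀ := approxSolution_line x m
    have e := hL (jetOf (approxSolution G Q u₀ c m) (x, -x)) (by rwa [hmem])
    beta_reduce at e
    rw [eq_zero_of_vanishing_on_equation hW hG hQ hu₀ hc (le_max_left _ _) hr₁
        (fun p hp hpe => (hP p hp hpe).1) x,
      eq_zero_of_vanishing_on_equation hW hG hQ hu₀ hc (le_max_right _ _) hr₂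
        (fun p hp hpe => (hP p hp hpe).2) x, hmem,
      (jetOf_approxSolution_line hW hG hQ hu₀ hc m x).1,
      (jetOf_approxSolution_line hW hG hQ hu₀ hc m x).2, zero_add, zero_add] at e
    rw [← e.1, ← e.2, ← Finset.sum_add_distrib]
    exact Finset.sum_congr rfl fun α _ => by ring
  simp only [hbot, hf, hg, hval hbs, hval h0s] at hflux
  simp only [Pi.zero_apply, mul_zero, Finset.sum_const_zero, intervalIntegral.integral_zero] at hflux
  have hpos : 0 < ∑ α, R α u₀ * R α u₀ :=
    Finset.sum_pos' (fun α _ => mul_self_nonneg _) ⟨α₀, Finset.mem_univ _,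
      mul_self_pos.2 hα₀⟩
  have hbx : ∀ x, ∑ α, R α u₀ * b x α = χ x * ∑ α, R α u₀ * R α u₀ := by
    intro x
    rw [Finset.mul_sum]
    exact Finset.sum_congr rfl fun α _ => by simp [hb]; ring
  simp only [hbx, intervalIntegral.integral_mul_const] at hflux
  have hχ : 0 < ∫ x in (-1 : ℝ)..1, χ x :=
    intervalIntegral.integral_pos (by norm_num) χ.continuous.continuousOn
      (fun x _ => χ.nonneg) ⟨0, by norm_num, by
        rw [χ.one_of_mem_closedBall (Metric.mem_closedBall_self χ.rIn_pos.le)]; exact one_pos⟩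
  exact (mul_pos hχ hpos).ne' hflux

end ChiralType

end

/-! ### The conservation law of a Killing covector. -/

noncomputable section

namespace ChiralType

variable {n : ℕ}

theorem hasDerivAt_sum_mul {H : Fin n → (Fin n → ℝ) → ℝ} {u v : Fin n → ℝ}
    (hH : ∀ α, DifferentiableAt ℝ (H α) u) (a b : Fin n → ℝ) :
    HasDerivAt (fun t : ℝ => ∑ α, H α (fun β => u β + t * v β) * (a α + t * b α))
      (∑ α, ((∑ β, v β * pderiv β (H α) u) * a α + H α u * b α)) 0 := by
  refine HasDerivAt.fun_sum fun α _ => ?_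
  have hl : HasDerivAt (fun t : ℝ => fun β => u β + t * v β) v 0 :=
    hasDerivAt_pi.2 fun β => by
      simpa using ((hasDerivAt_id (0 : ℝ)).mul_const (v β)).const_add (u β)
  have hu : (fun β => u β + 0 * v β) = u := by simp
  have h1 := (show HasFDerivAt (H α) (fderiv ℝ (H α) u) (fun β => u β + 0 * v β) by
    rw [hu]; exact (hH α).hasFDerivAt).comp_hasDerivAt (0 : ℝ) hl
  have h2 : HasDerivAt (fun t : ℝ => a α + t * b α) (b α) 0 := by
    simpa using ((hasDerivAt_id (0 : ℝ)).mul_const (b α)).const_add (a α)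
  refine (h1.fun_mul h2).congr_deriv ?_
  simp [fderiv_eq_sum_pderiv]

theorem contDiffOn_covDeriv {V : Set (Fin n → ℝ)} (hV : IsOpen V)
    {G : Fin n → Fin n → Fin n → (Fin n → ℝ) → ℝ} {R : Fin n → (Fin n → ℝ) → ℝ}
    (hG : ∀ α β γ, ContDiffOn ℝ ∞ (G α β γ) V) (hR : ∀ α, ContDiffOn ℝ ∞ (R α) V) (α β : Fin n) :
    ContDiffOn ℝ ∞ (covDeriv G R α β) V :=
  (contDiffOn_pderiv hV (hR β) α).sub (ContDiffOn.sum fun γ _ => (hG γ α β).mul (hR γ))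

/-- A Killing covector with closed `∇_α R_β dU^α ∧ dU^β` and `R_α Q^α = 0` is the characteristic
of a conservation law. -/
theorem exists_isConservationLaw {V : Set (Fin n → ℝ)} (hV : IsOpen V)
    {G : Fin n → Fin n → Fin n → (Fin n → ℝ) → ℝ} {Q R : Fin n → (Fin n → ℝ) → ℝ}
    (hG : ∀ α β γ, ContDiffOn ℝ ∞ (G α β γ) V) (hR : ∀ α, ContDiffOn ℝ ∞ (R α) V)
    (hK : IsKillingCovector V G R) (hcl : IsClosedTwoForm V (covDeriv G R))
    (hRQ : ∀ u ∈ V, ∑ α, R α u * Q α u = 0) {W : Set (Fin n → ℝ)} (hWV : W ⊆ V) (hW : IsOpen W)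
    (hstar : ∃ c ∈ W, StarConvex ℝ c W) :
    ∃ Ω : Fin n → (Fin n → ℝ) → ℝ, IsConservationLaw W G Q R
      (fun p => ∑ α, (R α (p.u 0 0) - Ω α (p.u 0 0)) * p.u 0 1 α)
      (fun p => ∑ α, Ω α (p.u 0 0) * p.u 1 0 α) := by
  obtain ⟨c, -, hc⟩ := hstar
  obtain ⟨Ω', hΩ', hpot⟩ := exists_potential_of_closed hW hc
    (w := fun α β u => covDeriv G R α β u - covDeriv G R β α u)
    (fun α β => ((contDiffOn_covDeriv hV hG hR α β).sub (contDiffOn_covDeriv hV hG hR β α)).mono hWV)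
    (fun u _ α β => by ring) (fun u hu α β γ => hcl u (hWV hu) α β γ)
  have hRW := fun α => (hR α).mono hWV
  have hΩs : ∀ α, ContDiffOn ℝ ∞ (fun u => 1 / 2 * Ω' α u) W := fun α =>
    contDiffOn_const.mul (hΩ' α)
  have hdiff : ∀ {h : (Fin n → ℝ) → ℝ}, ContDiffOn ℝ ∞ h W → ∀ u ∈ W, DifferentiableAt ℝ h u :=
    fun hh u hu => (hh.contDiffAt (hW.mem_nhds hu)).differentiableAt (by simp)
  have hpull : ∀ {h : (Fin n → ℝ) → ℝ}, ContDiffOn ℝ ∞ h W →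
      ContDiffOn ℝ ∞ (fun q : TruncJet n 1 => h (q.2.2 0 0)) {q | q.2.2 0 0 ∈ W} := fun hh =>
    hh.comp (by fun_prop) fun q hq => hq
  -- The differential of `Ω'` is `∇_α R_β - ∇_β R_α`, which is `2 ∇_α R_β` by the Killing equation;
  -- hence the factor `1/2`.
  refine ⟨fun α u => 1 / 2 * Ω' α u, ?_, ?_, ?_⟩
  · exact ⟨1, fun q => ∑ α, (R α (q.2.2 0 0) - 1 / 2 * Ω' α (q.2.2 0 0)) * q.2.2 0 1 α,
      ContDiffOn.sum fun α _ => (hpull ((hRW α).sub (hΩs α))).mul (by fun_prop), fun p _ => rfl⟩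
  · exact ⟨1, fun q => ∑ α, (1 / 2 * Ω' α (q.2.2 0 0)) * q.2.2 1 0 α,
      ContDiffOn.sum fun α _ => (hpull (hΩs α)).mul (by fun_prop), fun p _ => rfl⟩
  · intro p hp
    have hx := (hasDerivAt_sum_mul (v := p.u 1 0)
      (fun α => hdiff ((hRW α).sub (hΩs α)) _ hp) (p.u 0 1) (p.u 1 1)).deriv
    have hy := (hasDerivAt_sum_mul (v := p.u 0 1)
      (fun α => hdiff (hΩs α) _ hp) (p.u 1 0) (p.u 1 1)).deriv
    have hpd : ∀ α β, pderiv β (fun u => 1 / 2 * Ω' α u) (p.u 0 0) =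
        1 / 2 * pderiv β (Ω' α) (p.u 0 0) := fun α β => by
      rw [pderiv, fderiv_const_mul (hdiff (hΩ' α) _ hp)]; rfl
    have hpd' : ∀ α β, pderiv β (fun u => R α u - 1 / 2 * Ω' α u) (p.u 0 0) =
        pderiv β (R α) (p.u 0 0) - 1 / 2 * pderiv β (Ω' α) (p.u 0 0) := fun α β => by
      rw [← hpd, pderiv, fderiv_fun_sub (hdiff (hRW α) _ hp) (hdiff (hΩs α) _ hp)]; rfl
    refine (congrArg₂ (· + ·) hx hy).trans ?_
    simp only [hpd, hpd', chiralDelta, mul_add, Finset.sum_add_distrib]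
    rw [hRQ _ (hWV hp)]
    -- This equates the coefficients of `U^β_x U^γ_y` in the divergence and in `R_α Δ^α`.
    have hGR : ∀ β γ, ∑ α, G α β γ (p.u 0 0) * R α (p.u 0 0) = pderiv β (R γ) (p.u 0 0) -
        1 / 2 * (pderiv β (Ω' γ) (p.u 0 0) - pderiv γ (Ω' β) (p.u 0 0)) := by
      intro β γ
      have e1 := hpot _ hp β γ
      have e2 := hK _ (hWV hp) β γ
      rw [e1]
      have e3 : covDeriv G R β γ (p.u 0 0) = pderiv β (R γ) (p.u 0 0) -
        ∑ α, G α β γ (p.u 0 0) * R α (p.u 0 0) := rfl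
      linarith
    have hmain : ∑ α, R α (p.u 0 0) * ∑ β, ∑ γ, G α β γ (p.u 0 0) * p.u 1 0 β * p.u 0 1 γ =
        ∑ β, ∑ γ, (pderiv β (R γ) (p.u 0 0) -
        1 / 2 * (pderiv β (Ω' γ) (p.u 0 0) - pderiv γ (Ω' β) (p.u 0 0))) *
          p.u 1 0 β * p.u 0 1 γ := by
      simp only [← hGR, Finset.mul_sum, Finset.sum_mul]
      rw [Finset.sum_comm]
      refine Finset.sum_congr rfl fun β _ => ?_
      rw [Finset.sum_comm]
      refine Finset.sum_congr rfl fun γ _ => Finset.sum_congr rfl fun α _ => by ring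
    have h1 : ∑ α, (∑ β, p.u 1 0 β * (pderiv β (R α) (p.u 0 0) -
        1 / 2 * pderiv β (Ω' α) (p.u 0 0))) * p.u 0 1 α = ∑ β, ∑ γ, (pderiv β (R γ) (p.u 0 0) -
        1 / 2 * pderiv β (Ω' γ) (p.u 0 0)) * p.u 1 0 β * p.u 0 1 γ := by
      simp only [Finset.sum_mul]
      rw [Finset.sum_comm]
      exact Finset.sum_congr rfl fun β _ => Finset.sum_congr rfl fun γ _ => by ring
    have h2 : ∑ α, (∑ β, p.u 0 1 β * (1 / 2 * pderiv β (Ω' α) (p.u 0 0))) * p.u 1 0 α =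
        ∑ β, ∑ γ, (1 / 2 * pderiv γ (Ω' β) (p.u 0 0)) * p.u 1 0 β * p.u 0 1 γ := by
      simp only [Finset.sum_mul]
      exact Finset.sum_congr rfl fun β _ => Finset.sum_congr rfl fun γ _ => by ring
    rw [hmain, h1, h2]
    have h3 : ∑ β, ∑ γ, (pderiv β (R γ) (p.u 0 0) -
        1 / 2 * (pderiv β (Ω' γ) (p.u 0 0) - pderiv γ (Ω' β) (p.u 0 0))) *
          p.u 1 0 β * p.u 0 1 γ =
        (∑ β, ∑ γ, (pderiv β (R γ) (p.u 0 0) -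
        1 / 2 * pderiv β (Ω' γ) (p.u 0 0)) * p.u 1 0 β * p.u 0 1 γ) +
        ∑ β, ∑ γ, (1 / 2 * pderiv γ (Ω' β) (p.u 0 0)) * p.u 1 0 β * p.u 0 1 γ := by
      simp only [← Finset.sum_add_distrib]
      exact Finset.sum_congr rfl fun β _ => Finset.sum_congr rfl fun γ _ => by ring
    have h4 : ∑ α, R α (p.u 0 0) * p.u 1 1 α =
        ∑ α, (R α (p.u 0 0) - 1 / 2 * Ω' α (p.u 0 0)) * p.u 1 1 α +
        ∑ α, 1 / 2 * Ω' α (p.u 0 0) * p.u 1 1 α := by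
      rw [← Finset.sum_add_distrib]
      exact Finset.sum_congr rfl fun α _ => by ring
    rw [h3, h4]
    ring

end ChiralType

end

/-! ### Curvature and the Bianchi identity. -/

noncomputable section

namespace ChiralType

variable {n : ℕ} {E : Type*} [NormedAddCommGroup E] [NormedSpace ℝ E]

/-- The partial derivative `∂h/∂U^α` of a vector-valued function. -/
def vderiv (α : Fin n) (h : (Fin n → ℝ) → E) (u : Fin n → ℝ) : E :=
  fderiv ℝ h u (Pi.single α 1)

theorem vderiv_bilinear {F K : Type*} [NormedAddCommGroup F] [NormedSpace ℝ F]
    [NormedAddCommGroup K] [NormedSpace ℝ K] (B : E →L[ℝ] F →L[ℝ] K) {a : (Fin n → ℝ) → E}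
    {b : (Fin n → ℝ) → F} {u : Fin n → ℝ} (ha : DifferentiableAt ℝ a u)
    (hb : DifferentiableAt ℝ b u) (α : Fin n) :
    vderiv α (fun v => B (a v) (b v)) u = B (vderiv α a u) (b u) + B (a u) (vderiv α b u) := by
  rw [vderiv, (B.hasFDerivAt_of_bilinear ha.hasFDerivAt hb.hasFDerivAt).fderiv]
  simp [vderiv, add_comm]

theorem vderiv_sub {a b : (Fin n → ℝ) → E} {u : Fin n → ℝ} (ha : DifferentiableAt ℝ a u)
    (hb : DifferentiableAt ℝ b u) (α : Fin n) :
    vderiv α (fun v => a v - b v) u = vderiv α a u - vderiv α b u := by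
  rw [vderiv, fderiv_fun_sub ha hb]; rfl

theorem vderiv_add {a b : (Fin n → ℝ) → E} {u : Fin n → ℝ} (ha : DifferentiableAt ℝ a u)
    (hb : DifferentiableAt ℝ b u) (α : Fin n) :
    vderiv α (fun v => a v + b v) u = vderiv α a u + vderiv α b u := by
  rw [vderiv, fderiv_fun_add ha hb]; rfl

section Smooth

variable {V : Set (Fin n → ℝ)} {h g : (Fin n → ℝ) → E}

theorem contDiffOn_vderiv (hV : IsOpen V) (hh : ContDiffOn ℝ ∞ h V) (α : Fin n) :
    ContDiffOn ℝ ∞ (vderiv α h) V :=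
  contDiffOn_fderiv_apply hV hh _

theorem ContDiffOn.differentiableAt_of_isOpen (hV : IsOpen V) (hh : ContDiffOn ℝ ∞ h V)
    {u : Fin n → ℝ} (hu : u ∈ V) : DifferentiableAt ℝ h u :=
  (hh.contDiffAt (hV.mem_nhds hu)).differentiableAt (by simp)

theorem vderiv_congr (hV : IsOpen V) (hgh : EqOn g h V) {u : Fin n → ℝ} (hu : u ∈ V) (α : Fin n) :
    vderiv α g u = vderiv α h u := by
  rw [vderiv, (hgh.eventuallyEq_of_mem (hV.mem_nhds hu)).fderiv_eq, vderiv]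

theorem vderiv_comm (hV : IsOpen V) (hh : ContDiffOn ℝ ∞ h V) {u : Fin n → ℝ} (hu : u ∈ V)
    (α β : Fin n) : vderiv α (vderiv β h) u = vderiv β (vderiv α h) u := by
  have hs : IsSymmSndFDerivAt ℝ h u := (hh.contDiffAt (hV.mem_nhds hu)).isSymmSndFDerivAt
    (by simp; exact WithTop.coe_le_coe.2 le_top)
  have hd : DifferentiableAt ℝ (fderiv ℝ h) u :=
    ((contDiffOn_fderiv hV hh).contDiffAt (hV.mem_nhds hu)).differentiableAt (by simp)
  have hv : ∀ v w : Fin n → ℝ, fderiv ℝ (fun z => fderiv ℝ h z v) u w =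
      fderiv ℝ (fderiv ℝ h) u w v := fun v w => by
    rw [fderiv_clm_apply hd (differentiableAt_const v)]
    simp
  change fderiv ℝ (fun z => fderiv ℝ h z _) u _ = fderiv ℝ (fun z => fderiv ℝ h z _) u _
  rw [hv, hv]
  exact hs _ _

end Smooth

/-- The curvature `∂_α C_β - ∂_β C_α - [C_α, C_β]` of the connection `∂_α - [C_α, ·]`. -/
def curvature (br : E →L[ℝ] E →L[ℝ] E) (C : Fin n → (Fin n → ℝ) → E) (α β : Fin n)
    (u : Fin n → ℝ) : E :=
  vderiv α (C β) u - vderiv β (C α) u - br (C α u) (C β u)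

section Bianchi

variable {br : E →L[ℝ] E →L[ℝ] E} {f : E →L[ℝ] E →L[ℝ] ℝ} {V : Set (Fin n → ℝ)}
  {C : Fin n → (Fin n → ℝ) → E} {P : (Fin n → ℝ) → E}

theorem curvature_antisymm (hskew : ∀ x y, br x y = -br y x) (α β : Fin n) (u : Fin n → ℝ) :
    curvature br C α β u = -curvature br C β α u := by
  rw [curvature, curvature, hskew (C α u)]
  abel

theorem contDiffOn_curvature (hV : IsOpen V) (hC : ∀ α, ContDiffOn ℝ ∞ (C α) V) (α β : Fin n) :
    ContDiffOn ℝ ∞ (curvature br C α β) V :=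
  ((contDiffOn_vderiv hV (hC β) α).sub (contDiffOn_vderiv hV (hC α) β)).sub
    ((br.contDiff.comp_contDiffOn (hC α)).clm_apply (hC β))

theorem vderiv_curvature (hV : IsOpen V) (hC : ∀ α, ContDiffOn ℝ ∞ (C α) V) {u : Fin n → ℝ}
    (hu : u ∈ V) (γ α β : Fin n) :
    vderiv γ (curvature br C α β) u = vderiv γ (vderiv α (C β)) u - vderiv γ (vderiv β (C α)) u -
      (br (vderiv γ (C α) u) (C β u) + br (C α u) (vderiv γ (C β) u)) := by
  have d1 := ContDiffOn.differentiableAt_of_isOpen hV (contDiffOn_vderiv hV (hC β) α) hu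
  have d2 := ContDiffOn.differentiableAt_of_isOpen hV (contDiffOn_vderiv hV (hC α) β) hu
  have d3 := ContDiffOn.differentiableAt_of_isOpen hV
    ((br.contDiff.comp_contDiffOn (hC α)).clm_apply (hC β)) hu
  have e1 := vderiv_sub (d1.sub d2) d3 γ
  have e2 := vderiv_sub d1 d2 γ
  have e3 := vderiv_bilinear br (ContDiffOn.differentiableAt_of_isOpen hV (hC α) hu)
    (ContDiffOn.differentiableAt_of_isOpen hV (hC β) hu) γ
  exact e1.trans (congrArg₂ (· - ·) e2 e3)

/-- The Bianchi identity, paired with a covariantly constant section. -/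
theorem curvature_pairing_closed (hskew : ∀ x y, br x y = -br y x)
    (hjac : ∀ x y z, br (br x y) z + br (br y z) x + br (br z x) y = 0)
    (hinv : ∀ x y z, f (br x y) z = f x (br y z)) (hV : IsOpen V)
    (hC : ∀ α, ContDiffOn ℝ ∞ (C α) V) (hP : ContDiffOn ℝ ∞ P V)
    (hpar : ∀ u ∈ V, ∀ α, vderiv α P u = br (C α u) (P u)) {u : Fin n → ℝ} (hu : u ∈ V)
    (α β γ : Fin n) :
    pderiv α (fun v => f (curvature br C β γ v) (P v)) u +
      pderiv β (fun v => f (curvature br C γ α v) (P v)) u +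
      pderiv γ (fun v => f (curvature br C α β v) (P v)) u = 0 := by
  -- Since `P` is parallel, invariance of `f` moves the connection term onto the curvature: a
  -- derivative of the pairing is the pairing of the covariant derivative `∂F + [F, C]` with `P`.
  have hd : ∀ α β γ, pderiv α (fun v => f (curvature br C β γ v) (P v)) u =
      f (vderiv α (curvature br C β γ) u + br (curvature br C β γ u) (C α u)) (P u) := by
    intro α β γ
    have := vderiv_bilinear f
      (ContDiffOn.differentiableAt_of_isOpen hV (contDiffOn_curvature (br := br) hV hC β γ) hu)
      (ContDiffOn.differentiableAt_of_isOpen hV hP hu) α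
    rw [map_add, add_apply, hinv, ← hpar u hu]
    exact this
  rw [hd, hd, hd, ← add_apply, ← map_add, ← add_apply, ← map_add]
  -- Bianchi: second derivatives of `C` cancel by symmetry, terms with one derivative by skewness,
  -- triple brackets by Jacobi.
  have : vderiv α (curvature br C β γ) u + br (curvature br C β γ u) (C α u) +
      (vderiv β (curvature br C γ α) u + br (curvature br C γ α u) (C β u)) +
      (vderiv γ (curvature br C α β) u + br (curvature br C α β u) (C γ u)) = 0 := by
    rw [vderiv_curvature hV hC hu, vderiv_curvature hV hC hu, vderiv_curvature hV hC hu,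
      vderiv_comm hV (hC γ) hu α β, vderiv_comm hV (hC α) hu β γ, vderiv_comm hV (hC β) hu γ α,
      hskew (C α u), hskew (C β u) (vderiv _ _ _), hskew (C γ u)]
    simp only [curvature, map_sub, sub_apply]
    have hj := hjac (C α u) (C β u) (C γ u)
    rw [← neg_eq_zero] at hj
    rw [← hj]
    abel
  rw [this, map_zero, zero_apply]

end Bianchi

/-- The summand built from `r` is exact and drops out by symmetry of second derivatives. As `w` is
already skew, the antisymmetrisation in `IsClosedTwoForm` only doubles it. -/
theorem isClosedTwoForm_of_eq {V : Set (Fin n → ℝ)} (hV : IsOpen V)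
    {w c : Fin n → Fin n → (Fin n → ℝ) → ℝ} {r : Fin n → (Fin n → ℝ) → ℝ}
    (hc : ∀ α β, ContDiffOn ℝ ∞ (c α β) V) (hr : ∀ α, ContDiffOn ℝ ∞ (r α) V)
    (hw : ∀ u ∈ V, ∀ α β, w α β u = c α β u + (pderiv α (r β) u - pderiv β (r α) u))
    (hanti : ∀ u ∈ V, ∀ α β, c α β u = -c β α u)
    (hclosed : ∀ u ∈ V, ∀ α β γ,
      pderiv α (c β γ) u + pderiv β (c γ α) u + pderiv γ (c α β) u = 0) :
    IsClosedTwoForm V w := by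
  intro u hu α β γ
  have key : ∀ α β γ, pderiv α (fun v => w β γ v - w γ β v) u =
      2 * (pderiv α (c β γ) u + (pderiv α (pderiv β (r γ)) u - pderiv α (pderiv γ (r β)) u)) := by
    intro α β γ
    have e : EqOn (fun v => w β γ v - w γ β v)
        (fun v => (c β γ v + (pderiv β (r γ) v - pderiv γ (r β) v)) +
          (c β γ v + (pderiv β (r γ) v - pderiv γ (r β) v))) V := by
      intro v hv
      simp only [hw v hv]
      rw [hanti v hv γ β]
      ring
    have d1 := ContDiffOn.differentiableAt_of_isOpen hV (hc β γ) hu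
    have d2 := ContDiffOn.differentiableAt_of_isOpen hV (contDiffOn_pderiv hV (hr γ) β) hu
    have d3 := ContDiffOn.differentiableAt_of_isOpen hV (contDiffOn_pderiv hV (hr β) γ) hu
    have e2 : vderiv α (fun v => c β γ v + (pderiv β (r γ) v - pderiv γ (r β) v)) u =
        vderiv α (c β γ) u + (vderiv α (pderiv β (r γ)) u - vderiv α (pderiv γ (r β)) u) := by
      rw [vderiv_add d1 (d2.fun_sub d3), vderiv_sub d2 d3]
    have e3 := (vderiv_congr hV e hu α).trans
      (vderiv_add (d1.fun_add (d2.fun_sub d3)) (d1.fun_add (d2.fun_sub d3)) α)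
    rw [e2, ← two_mul] at e3
    exact e3
  have hcomm : ∀ α β γ, pderiv α (pderiv β (r γ)) u = pderiv β (pderiv α (r γ)) u :=
    fun α β γ => vderiv_comm hV (hr γ) hu α β
  rw [key, key, key, hcomm β α γ, hcomm γ β α, hcomm α γ β]
  linear_combination 2 * hclosed u hu α β γ

/-! ### The covectors `f(S, M)` and `f(S, N)`. -/

section LaxEquations

variable {br : E →L[ℝ] E →L[ℝ] E} {f : E →L[ℝ] E →L[ℝ] ℝ} {V : Set (Fin n → ℝ)}
  {G : Fin n → Fin n → Fin n → (Fin n → ℝ) → ℝ} {A B S : Fin n → (Fin n → ℝ) → E}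
  {M N : (Fin n → ℝ) → E}

theorem contDiffOn_pairing {a b : (Fin n → ℝ) → E} (ha : ContDiffOn ℝ ∞ a V)
    (hb : ContDiffOn ℝ ∞ b V) : ContDiffOn ℝ ∞ (fun u => f (a u) (b u)) V :=
  (f.contDiff.comp_contDiffOn ha).clm_apply hb

theorem vderiv_of_eq_sub (hV : IsOpen V) (hA : ∀ α, ContDiffOn ℝ ∞ (A α) V)
    (hB : ∀ α, ContDiffOn ℝ ∞ (B α) V) (hS : ∀ u ∈ V, ∀ α, S α u = A α u - B α u)
    {u : Fin n → ℝ} (hu : u ∈ V) (α β : Fin n) :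
    vderiv α (S β) u = vderiv α (A β) u - vderiv α (B β) u := by
  rw [vderiv_congr hV (fun v hv => hS v hv β) hu,
    vderiv_sub (ContDiffOn.differentiableAt_of_isOpen hV (hA β) hu)
      (ContDiffOn.differentiableAt_of_isOpen hV (hB β) hu)]

/-- `G` enters `∇R` only through `G^γ_{αβ} S_γ`, which the Lax equation expresses by `A` and `B`. -/
theorem covDeriv_pairing_eq (hV : IsOpen V) (hSs : ∀ α, ContDiffOn ℝ ∞ (S α) V)
    {P : (Fin n → ℝ) → E} (hP : ContDiffOn ℝ ∞ P V)
    (hGS : ∀ u ∈ V, ∀ β γ, vderiv γ (A β) u - vderiv β (B γ) u + br (A β u) (B γ u) =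
      ∑ α, G α β γ u • S α u) {u : Fin n → ℝ} (hu : u ∈ V) (α β : Fin n) :
    covDeriv G (fun α u => f (S α u) (P u)) α β u =
      f (vderiv α (S β) u) (P u) + f (S β u) (vderiv α P u) -
      f (vderiv β (A α) u - vderiv α (B β) u + br (A α u) (B β u)) (P u) := by
  rw [hGS u hu, map_sum, covDeriv]
  congr 1
  · exact vderiv_bilinear f (ContDiffOn.differentiableAt_of_isOpen hV (hSs β) hu)
      (ContDiffOn.differentiableAt_of_isOpen hV hP hu) α
  · simp

/-- Invariance turns `f(S_β, [A_α, N])` into `f([S_β, A_α], N)`; after substituting `S = A - B` all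
terms containing `B` cancel. -/
theorem covDeriv_pairing_right (hskew : ∀ x y, br x y = -br y x)
    (hinv : ∀ x y z, f (br x y) z = f x (br y z)) (hV : IsOpen V)
    (hA : ∀ α, ContDiffOn ℝ ∞ (A α) V) (hB : ∀ α, ContDiffOn ℝ ∞ (B α) V)
    (hSs : ∀ α, ContDiffOn ℝ ∞ (S α) V) (hN : ContDiffOn ℝ ∞ N V)
    (hS : ∀ u ∈ V, ∀ α, S α u = A α u - B α u)
    (hGS : ∀ u ∈ V, ∀ β γ, vderiv γ (A β) u - vderiv β (B γ) u + br (A β u) (B γ u) =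
      ∑ α, G α β γ u • S α u)
    (hpar : ∀ u ∈ V, ∀ α, vderiv α N u = br (A α u) (N u)) {u : Fin n → ℝ} (hu : u ∈ V)
    (α β : Fin n) :
    covDeriv G (fun α u => f (S α u) (N u)) α β u = f (curvature br A α β u) (N u) := by
  rw [covDeriv_pairing_eq (br := br) hV hSs hN hGS hu, hpar u hu, ← hinv,
    vderiv_of_eq_sub hV hA hB hS hu, hS u hu, curvature, ← add_apply, ← map_add, ← sub_apply,
    ← map_sub]
  congr 2
  rw [map_sub, sub_apply, hskew (A β u), hskew (B β u)]
  abel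

/-- The mirror image under `x ↔ y` has `G` with its lower indices transposed; undoing the
transposition costs the exact term. -/
theorem covDeriv_pairing_left (hinv : ∀ x y z, f (br x y) z = f x (br y z)) (hV : IsOpen V)
    (hA : ∀ α, ContDiffOn ℝ ∞ (A α) V) (hB : ∀ α, ContDiffOn ℝ ∞ (B α) V)
    (hSs : ∀ α, ContDiffOn ℝ ∞ (S α) V) (hM : ContDiffOn ℝ ∞ M V)
    (hS : ∀ u ∈ V, ∀ α, S α u = A α u - B α u)
    (hGS : ∀ u ∈ V, ∀ β γ, vderiv γ (A β) u - vderiv β (B γ) u + br (A β u) (B γ u) =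
      ∑ α, G α β γ u • S α u)
    (hpar : ∀ u ∈ V, ∀ α, vderiv α M u = br (B α u) (M u)) {u : Fin n → ℝ} (hu : u ∈ V)
    (α β : Fin n) :
    covDeriv G (fun α u => f (S α u) (M u)) α β u = f (curvature br B α β u) (M u) +
      (pderiv α (fun u => f (S β u) (M u)) u - pderiv β (fun u => f (S α u) (M u)) u) := by
  have hp : ∀ α β, pderiv α (fun u => f (S β u) (M u)) u =
      f (vderiv α (S β) u + br (S β u) (B α u)) (M u) := by
    intro α β
    rw [map_add, add_apply, hinv, ← hpar u hu]
    exact vderiv_bilinear f (ContDiffOn.differentiableAt_of_isOpen hV (hSs β) hu)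
      (ContDiffOn.differentiableAt_of_isOpen hV hM hu) α
  rw [covDeriv_pairing_eq (br := br) hV hSs hM hGS hu, hpar u hu, ← hinv, hp, hp]
  rw [← add_apply, ← map_add, ← sub_apply, ← map_sub, ← sub_apply, ← map_sub, ← add_apply,
    ← map_add]
  congr 2
  rw [vderiv_of_eq_sub hV hA hB hS hu, vderiv_of_eq_sub hV hA hB hS hu, hS u hu, hS u hu,
    curvature]
  simp only [map_sub, sub_apply]
  abel

theorem killing_and_closed_right (hskew : ∀ x y, br x y = -br y x)
    (hjac : ∀ x y z, br (br x y) z + br (br y z) x + br (br z x) y = 0)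
    (hinv : ∀ x y z, f (br x y) z = f x (br y z)) (hV : IsOpen V)
    (hA : ∀ α, ContDiffOn ℝ ∞ (A α) V) (hB : ∀ α, ContDiffOn ℝ ∞ (B α) V)
    (hSs : ∀ α, ContDiffOn ℝ ∞ (S α) V) (hN : ContDiffOn ℝ ∞ N V)
    (hS : ∀ u ∈ V, ∀ α, S α u = A α u - B α u)
    (hGS : ∀ u ∈ V, ∀ β γ, vderiv γ (A β) u - vderiv β (B γ) u + br (A β u) (B γ u) =
      ∑ α, G α β γ u • S α u)
    (hpar : ∀ u ∈ V, ∀ α, vderiv α N u = br (A α u) (N u)) :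
    IsKillingCovector V G (fun α u => f (S α u) (N u)) ∧
      IsClosedTwoForm V (covDeriv G (fun α u => f (S α u) (N u))) := by
  have hw := fun u (hu : u ∈ V) => covDeriv_pairing_right (f := f) hskew hinv hV hA hB hSs hN hS
    hGS hpar hu
  have hanti : ∀ u α β, f (curvature br A α β u) (N u) = -f (curvature br A β α u) (N u) := by
    intro u α β
    rw [curvature_antisymm hskew, map_neg, neg_apply]
  refine ⟨fun u hu α β => ?_, isClosedTwoForm_of_eq hV
    (c := fun α β u => f (curvature br A α β u) (N u)) (r := fun _ _ => 0)
    (fun α β => contDiffOn_pairing (contDiffOn_curvature hV hA α β) hN)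
    (fun _ => contDiffOn_const) (fun u hu α β => ?_) (fun u _ => hanti u)
    (fun u hu => curvature_pairing_closed hskew hjac hinv hV hA hN hpar hu)⟩
  · rw [hw u hu, hw u hu, hanti, neg_add_cancel]
  · rw [hw u hu]
    simp [pderiv]

theorem killing_and_closed_left (hskew : ∀ x y, br x y = -br y x)
    (hjac : ∀ x y z, br (br x y) z + br (br y z) x + br (br z x) y = 0)
    (hinv : ∀ x y z, f (br x y) z = f x (br y z)) (hV : IsOpen V)
    (hA : ∀ α, ContDiffOn ℝ ∞ (A α) V) (hB : ∀ α, ContDiffOn ℝ ∞ (B α) V)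
    (hSs : ∀ α, ContDiffOn ℝ ∞ (S α) V) (hM : ContDiffOn ℝ ∞ M V)
    (hS : ∀ u ∈ V, ∀ α, S α u = A α u - B α u)
    (hGS : ∀ u ∈ V, ∀ β γ, vderiv γ (A β) u - vderiv β (B γ) u + br (A β u) (B γ u) =
      ∑ α, G α β γ u • S α u)
    (hpar : ∀ u ∈ V, ∀ α, vderiv α M u = br (B α u) (M u)) :
    IsKillingCovector V G (fun α u => f (S α u) (M u)) ∧
      IsClosedTwoForm V (covDeriv G (fun α u => f (S α u) (M u))) := by
  have hw := fun u (hu : u ∈ V) => covDeriv_pairing_left (f := f) hinv hV hA hB hSs hM hS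
    hGS hpar hu
  have hanti : ∀ u α β, f (curvature br B α β u) (M u) = -f (curvature br B β α u) (M u) := by
    intro u α β
    rw [curvature_antisymm hskew, map_neg, neg_apply]
  refine ⟨fun u hu α β => ?_, isClosedTwoForm_of_eq hV
    (c := fun α β u => f (curvature br B α β u) (M u)) (r := fun α u => f (S α u) (M u))
    (fun α β => contDiffOn_pairing (contDiffOn_curvature hV hB α β) hM)
    (fun α => contDiffOn_pairing (hSs α) hM) hw (fun u _ => hanti u)
    (fun u hu => curvature_pairing_closed hskew hjac hinv hV hB hM hpar hu)⟩
  rw [hw u hu, hw u hu, hanti u β α]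
  ring

end LaxEquations

end ChiralType

end

/-! ### The matrix Lie algebra in coordinates. -/

noncomputable section

namespace ChiralType

variable {n m : ℕ} {𝔤 : LieSubalgebra ℝ (Matrix (Fin m) (Fin m) ℂ)}

/-- A jet with prescribed `U`, `U_x`, `U_y`, `U_xy`. -/
def secondOrderJet (u ξ η ζ : Fin n → ℝ) : Jet n :=
  ⟨0, 0, fun i j => match i, j with
    | 0, 0 => u
    | 1, 0 => ξ
    | 0, 1 => η
    | 1, 1 => ζ
    | _, _ => 0⟩

section Coordinates

variable {d : ℕ} (e : 𝔤 ≃ₗ[ℝ] (Fin d → ℝ))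

/-- The inclusion of `𝔤` into matrices is injective, so coordinates are a linear function of the
entries. -/
theorem SmoothMat.contDiffOn_coordinates {V : Set (Fin n → ℝ)} {X : (Fin n → ℝ) → 𝔤}
    (hX : SmoothMat V X) : ContDiffOn ℝ ∞ (fun u => e (X u)) V := by
  let ι : (Fin d → ℝ) →ₗ[ℝ] (Fin m → Fin m → ℂ) :=
    { toFun := fun x => (e.symm x : Matrix (Fin m) (Fin m) ℂ)
      map_add' := fun x y => by rw [map_add]; rfl
      map_smul' := fun c x => by rw [map_smul]; rfl }
  have hι : LinearMap.ker ι = ⊥ := LinearMap.ker_eq_bot.2 fun x y hxy =>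
    e.symm.injective (Subtype.ext hxy)
  obtain ⟨r, hr⟩ := ι.exists_leftInverse_of_injective hι
  have h1 : ContDiffOn ℝ ∞ (fun u (i j : Fin m) => (X u : Matrix (Fin m) (Fin m) ℂ) i j) V :=
    contDiffOn_pi.2 fun i => contDiffOn_pi.2 fun j => hX i j
  refine (r.toContinuousLinearMap.contDiff.comp_contDiffOn h1).congr fun u _ => ?_
  have h2 := LinearMap.congr_fun hr (e (X u))
  simp only [LinearMap.comp_apply, LinearMap.id_apply] at h2
  rw [← h2]
  change r _ = r _
  congr 1
  funext i j
  change ((e.symm (e (X u)) : 𝔤) : Matrix (Fin m) (Fin m) ℂ) i j = _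
  rw [e.symm_apply_apply]

/-- The Lie bracket in coordinates. -/
def coordBracket : (Fin d → ℝ) →L[ℝ] (Fin d → ℝ) →L[ℝ] (Fin d → ℝ) :=
  LinearMap.toContinuousBilinearMap
    (LinearMap.mk₂ ℝ (fun x y => e ⁅e.symm x, e.symm y⁆)
      (fun x y z => by simp) (fun c x y => by simp) (fun x y z => by simp) (fun c x y => by simp))

/-- The Killing form in coordinates. -/
def coordKilling : (Fin d → ℝ) →L[ℝ] (Fin d → ℝ) →L[ℝ] ℝ :=
  LinearMap.toContinuousBilinearMap
    (LinearMap.mk₂ ℝ (fun x y => killingForm ℝ 𝔤 (e.symm x) (e.symm y))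
      (fun x y z => by simp) (fun c x y => by simp) (fun x y z => by simp) (fun c x y => by simp))

theorem coordBracket_apply (x y : 𝔤) : coordBracket e (e x) (e y) = e ⁅x, y⁆ := by
  simp [coordBracket, LinearMap.toContinuousBilinearMap_apply]

theorem coordBracket_apply' (x y : Fin d → ℝ) : coordBracket e x y = e ⁅e.symm x, e.symm y⁆ := rfl

theorem coordKilling_apply (x y : 𝔤) : coordKilling e (e x) (e y) = killingForm ℝ 𝔤 x y := by
  simp [coordKilling, LinearMap.toContinuousBilinearMap_apply]

theorem coordKilling_apply' (x y : Fin d → ℝ) :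
    coordKilling e x y = killingForm ℝ 𝔤 (e.symm x) (e.symm y) := rfl

theorem coordBracket_skew (x y : Fin d → ℝ) : coordBracket e x y = -coordBracket e y x := by
  rw [coordBracket_apply', coordBracket_apply', ← lie_skew, map_neg]

theorem coordBracket_jacobi (x y z : Fin d → ℝ) :
    coordBracket e (coordBracket e x y) z + coordBracket e (coordBracket e y z) x +
      coordBracket e (coordBracket e z x) y = 0 := by
  simp only [coordBracket_apply', e.symm_apply_apply, ← map_add]
  have h : ∀ a b c : 𝔤, ⁅⁅a, b⁆, c⁆ + ⁅⁅b, c⁆, a⁆ + ⁅⁅c, a⁆, b⁆ = 0 := fun a b c => by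
    rw [← neg_eq_zero, neg_add, neg_add, lie_skew, lie_skew, lie_skew, ← lie_jacobi a b c]
    abel
  rw [h, map_zero]

theorem coordKilling_invariant (x y z : Fin d → ℝ) :
    coordKilling e (coordBracket e x y) z = coordKilling e x (coordBracket e y z) := by
  simp only [coordKilling_apply', coordBracket_apply', e.symm_apply_apply]
  exact LieModule.traceForm_apply_lie_apply ℝ 𝔤 𝔤 _ _ _

/-- `D_y` of `A_α U^α_x + M` and `D_x` of `B_α U^α_y + N` have the same shape: `v` is the velocity
of `U`, `ξ` the first derivative in the Lax matrix and `ζ` is `U_xy`. -/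
theorem hasDerivAt_laxPath {V : Set (Fin n → ℝ)} (hV : IsOpen V) {A : Fin n → (Fin n → ℝ) → 𝔤}
    {M : (Fin n → ℝ) → 𝔤} (hA : ∀ α, SmoothMat V (A α)) (hM : SmoothMat V M) {u : Fin n → ℝ}
    (hu : u ∈ V) (ξ ζ v : Fin n → ℝ) :
    HasDerivAt (fun t : ℝ => e ((∑ α, (ξ α + t * ζ α) • A α (fun β => u β + t * v β)) +
        M (fun β => u β + t * v β)))
      ((∑ α, (ξ α • fderiv ℝ (fun u => e (A α u)) u v + ζ α • e (A α u))) +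
        fderiv ℝ (fun u => e (M u)) u v) 0 := by
  have hl : HasDerivAt (fun t : ℝ => fun β => u β + t * v β) v 0 :=
    hasDerivAt_pi.2 fun β => by
      simpa using ((hasDerivAt_id (0 : ℝ)).mul_const (v β)).const_add (u β)
  have hu0 : (fun β => u β + 0 * v β) = u := by simp
  have hX : ∀ {X : (Fin n → ℝ) → 𝔤}, SmoothMat V X →
      HasDerivAt (fun t : ℝ => e (X (fun β => u β + t * v β)))
        (fderiv ℝ (fun u => e (X u)) u v) 0 := fun {X} h =>
    HasFDerivAt.comp_hasDerivAt (l := fun u => e (X u)) (0 : ℝ) (show HasFDerivAt (fun u => e (X u)) (fderiv ℝ (fun u => e (X u)) u) (fun β => u β + 0 * v β) by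
      rw [hu0]
      exact (ContDiffOn.differentiableAt_of_isOpen hV
        (h.contDiffOn_coordinates e) hu).hasFDerivAt) hl
  have h1 : ∀ α, HasDerivAt (fun t : ℝ => ξ α + t * ζ α) (ζ α) 0 := fun α => by
    simpa using ((hasDerivAt_id (0 : ℝ)).mul_const (ζ α)).const_add (ξ α)
  have h2 := (HasDerivAt.fun_sum (u := Finset.univ)
    fun α _ => (h1 α).fun_smul (hX (hA α))).fun_add (hX hM)
  refine (h2.congr_deriv ?_).congr_of_eventuallyEq (Filter.Eventually.of_forall fun t => ?_)
  · simp
  · simp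

theorem matrix_deriv_eq {F : ℝ → 𝔤} {F' : Fin d → ℝ} (hF : HasDerivAt (fun t => e (F t)) F' 0) :
    (Matrix.of fun i j => deriv (fun t => (F t : Matrix (Fin m) (Fin m) ℂ) i j) 0) =
      (e.symm F' : Matrix (Fin m) (Fin m) ℂ) := by
  ext i j
  let l : (Fin d → ℝ) →ₗ[ℝ] ℂ :=
    { toFun := fun x => (e.symm x : Matrix (Fin m) (Fin m) ℂ) i j
      map_add' := fun x y => by rw [map_add]; rfl
      map_smul' := fun c x => by rw [map_smul]; rfl }
  have h := (l.toContinuousLinearMap.hasFDerivAt (x := e (F 0))).comp_hasDerivAt (0 : ℝ) hF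
  have h2 : (l.toContinuousLinearMap ∘ fun t => e (F t)) =
      fun t => (F t : Matrix (Fin m) (Fin m) ℂ) i j := by
    funext t
    change ((e.symm (e (F t)) : 𝔤) : Matrix (Fin m) (Fin m) ℂ) i j = _
    rw [e.symm_apply_apply]
  rw [h2] at h
  exact h.deriv

/-- The Lax identity evaluated on the jet with prescribed `U`, `U_x`, `U_y`, `U_xy`. -/
theorem IsLaxRepresentation.identity {V : Set (Fin n → ℝ)} (hV : IsOpen V)
    {G : Fin n → Fin n → Fin n → (Fin n → ℝ) → ℝ} {Q : Fin n → (Fin n → ℝ) → ℝ}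
    {A B : Fin n → (Fin n → ℝ) → 𝔤} {M N : (Fin n → ℝ) → 𝔤} {S : Fin n → (Fin n → ℝ) → 𝔤}
    (h : IsLaxRepresentation V G Q A B M N S) {u : Fin n → ℝ} (hu : u ∈ V) (ξ η ζ : Fin n → ℝ) :
    ((∑ α, (ξ α • fderiv ℝ (fun u => e (A α u)) u η + ζ α • e (A α u))) +
        fderiv ℝ (fun u => e (M u)) u η) -
      ((∑ α, (η α • fderiv ℝ (fun u => e (B α u)) u ξ + ζ α • e (B α u))) +
        fderiv ℝ (fun u => e (N u)) u ξ) +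
      coordBracket e ((∑ α, ξ α • e (A α u)) + e (M u)) ((∑ α, η α • e (B α u)) + e (N u)) =
    ∑ α, (ζ α + (∑ β, ∑ γ, G α β γ u * ξ β * η γ) + Q α u) • e (S α u) := by
  have hl := h.lax (secondOrderJet u ξ η ζ) hu
  have hA := matrix_deriv_eq e (hasDerivAt_laxPath e hV h.smooth_A h.smooth_M hu ξ ζ η)
  have hB := matrix_deriv_eq e (hasDerivAt_laxPath e hV h.smooth_B h.smooth_N hu η ζ ξ)
  have hA' : matDy (laxA A M) (secondOrderJet u ξ η ζ) = _ := hA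
  have hB' : matDx (laxB B N) (secondOrderJet u ξ η ζ) = _ := hB
  rw [hA', hB'] at hl
  have hl2 := congrArg e (show e.symm ((∑ α, (ξ α • fderiv ℝ (fun u => e (A α u)) u η +
        ζ α • e (A α u))) + fderiv ℝ (fun u => e (M u)) u η) -
      e.symm ((∑ α, (η α • fderiv ℝ (fun u => e (B α u)) u ξ + ζ α • e (B α u))) +
        fderiv ℝ (fun u => e (N u)) u ξ) +
      ⁅(∑ α, ξ α • A α u) + M u, (∑ α, η α • B α u) + N u⁆ =
      ∑ α, (ζ α + (∑ β, ∑ γ, G α β γ u * ξ β * η γ) + Q α u) • S α u from Subtype.ext hl)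
  rw [map_add, map_sub, e.apply_symm_apply, e.apply_symm_apply, ← coordBracket_apply] at hl2
  simp only [map_add, map_sum, map_smul] at hl2 ⊢
  exact hl2

end Coordinates

end ChiralType

end

/-! ### Separating the Lax identity by monomials in the derivatives. -/

noncomputable section

namespace ChiralType

variable {n m : ℕ} {𝔤 : LieSubalgebra ℝ (Matrix (Fin m) (Fin m) ℂ)}

section Equations

variable {d : ℕ} (e : 𝔤 ≃ₗ[ℝ] (Fin d → ℝ)) {V : Set (Fin n → ℝ)}
    {G : Fin n → Fin n → Fin n → (Fin n → ℝ) → ℝ} {Q : Fin n → (Fin n → ℝ) → ℝ}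
    {A B : Fin n → (Fin n → ℝ) → 𝔤} {M N : (Fin n → ℝ) → 𝔤} {S : Fin n → (Fin n → ℝ) → 𝔤}

namespace IsLaxRepresentation

theorem bracket_eq (h : IsLaxRepresentation V G Q A B M N S) (hV : IsOpen V) {u : Fin n → ℝ}
    (hu : u ∈ V) : coordBracket e (e (M u)) (e (N u)) = ∑ α, Q α u • e (S α u) := by
  simpa using h.identity e hV hu 0 0 0

theorem characteristic_eq (h : IsLaxRepresentation V G Q A B M N S) (hV : IsOpen V)
    {u : Fin n → ℝ} (hu : u ∈ V) (α : Fin n) : e (S α u) = e (A α u) - e (B α u) := by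
  have h1 := h.identity e hV hu 0 0 (Pi.single α 1)
  simp only [Pi.zero_apply, zero_smul, zero_add, Pi.single_apply, ite_smul, one_smul,
    Finset.sum_ite_eq', Finset.mem_univ, if_true, map_zero, Finset.sum_const_zero, add_zero,
    mul_zero, add_smul, Finset.sum_add_distrib, h.bracket_eq e hV hu] at h1
  exact (add_right_cancel h1).symm

theorem vderiv_right (h : IsLaxRepresentation V G Q A B M N S) (hV : IsOpen V)
    {u : Fin n → ℝ} (hu : u ∈ V) (β : Fin n) :
    vderiv β (fun u => e (N u)) u = coordBracket e (e (A β u)) (e (N u)) := by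
  have h1 := h.identity e hV hu (Pi.single β 1) 0 0
  simp only [Pi.zero_apply, zero_smul, zero_add, Pi.single_apply, ite_smul, one_smul,
    Finset.sum_ite_eq', Finset.mem_univ, if_true, map_zero, Finset.sum_const_zero, add_zero,
    mul_zero, smul_zero, map_add, add_apply, h.bracket_eq e hV hu, zero_sub] at h1
  rw [← add_assoc, add_eq_right, neg_add_eq_zero] at h1
  exact h1

theorem vderiv_left (h : IsLaxRepresentation V G Q A B M N S) (hV : IsOpen V)
    {u : Fin n → ℝ} (hu : u ∈ V) (γ : Fin n) :
    vderiv γ (fun u => e (M u)) u = coordBracket e (e (B γ u)) (e (M u)) := by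
  have h1 := h.identity e hV hu 0 (Pi.single γ 1) 0
  simp only [Pi.zero_apply, zero_smul, zero_add, Pi.single_apply, ite_smul, one_smul,
    Finset.sum_ite_eq', Finset.mem_univ, if_true, map_zero, Finset.sum_const_zero, add_zero,
    mul_zero, smul_zero, map_add, zero_mul, h.bracket_eq e hV hu, sub_zero] at h1
  rw [← add_assoc, add_eq_right] at h1
  rw [coordBracket_skew]
  exact eq_neg_of_add_eq_zero_left h1

/-- With `U_x` and `U_y` basis vectors and `U_xy = 0`, the terms of degree zero and one cancel by
the identities above, leaving the bilinear coefficient. -/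
theorem connection_eq (h : IsLaxRepresentation V G Q A B M N S) (hV : IsOpen V)
    {u : Fin n → ℝ} (hu : u ∈ V) (β γ : Fin n) :
    vderiv γ (fun u => e (A β u)) u - vderiv β (fun u => e (B γ u)) u +
      coordBracket e (e (A β u)) (e (B γ u)) = ∑ α, G α β γ u • e (S α u) := by
  have h1 := h.identity e hV hu (Pi.single β 1) (Pi.single γ 1) 0
  have hG : ∀ α, ∑ b, ∑ c, G α b c u * (Pi.single β 1 : Fin n → ℝ) b *
      (Pi.single γ 1 : Fin n → ℝ) c = G α β γ u := fun α => by
    simp [Pi.single_apply]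
  simp only [hG, Pi.zero_apply, zero_smul, zero_add, add_zero] at h1
  simp only [Pi.single_apply, ite_smul, one_smul, zero_smul,
    Finset.sum_ite_eq', Finset.mem_univ, if_true, map_add, add_apply, add_smul,
    Finset.sum_add_distrib, h.bracket_eq e hV hu] at h1
  have h2 := h.vderiv_left e hV hu γ
  rw [coordBracket_skew] at h2
  have h3 := h.vderiv_right e hV hu β
  simp only [vderiv] at h2 h3 ⊢
  rw [h2, h3] at h1
  rw [← add_right_cancel_iff (a := ∑ α, Q α u • e (S α u)), ← h1]
  abel

end IsLaxRepresentation

end Equations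

/-- Two elements orthogonal to `n` independent elements of a Lie algebra of dimension at most
`n + 1` with negative definite Killing form commute. -/
theorem lie_eq_zero_of_orthogonal {L : Type*} [LieRing L] [LieAlgebra ℝ L] [Module.Finite ℝ L]
    (hneg : ∀ X : L, X ≠ 0 → killingForm ℝ L X X < 0) (hdim : Module.finrank ℝ L ≤ n + 1)
    {s : Fin n → L} (hs : LinearIndependent ℝ s) {x y : L}
    (hx : ∀ α, killingForm ℝ L (s α) x = 0) (hy : ∀ α, killingForm ℝ L (s α) y = 0) :
    ⁅x, y⁆ = 0 := by
  let O : Submodule ℝ L := ⨅ α, LinearMap.ker (killingForm ℝ L (s α))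
  have hO : ∀ {z : L}, z ∈ O ↔ ∀ α, killingForm ℝ L (s α) z = 0 := by
    intro z; simp [O]
  -- An element of both would be Killing-orthogonal to itself; definiteness excludes this unless it
  -- is zero. Hence the dimensions add and `O` is at most a line.
  have hdisj : Disjoint (Submodule.span ℝ (range s)) O := by
    rw [Submodule.disjoint_def]
    intro z hz hzO
    by_contra hz0
    have h1 : Submodule.span ℝ (range s) ≤ LinearMap.ker ((killingForm ℝ L).flip z) := by
      rw [Submodule.span_le]
      rintro _ ⟨α, rfl⟩
      exact hO.1 hzO α
    exact (hneg z hz0).ne (h1 hz)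
  have h1 := Submodule.finrank_add_finrank_le_of_disjoint hdisj
  rw [finrank_span_eq_card hs, Fintype.card_fin] at h1
  have h2 : Module.finrank ℝ O ≤ 1 := by omega
  obtain ⟨v, hv⟩ := finrank_le_one_iff.1 h2
  obtain ⟨a, ha⟩ := hv ⟨x, hO.2 hx⟩
  obtain ⟨b, hb⟩ := hv ⟨y, hO.2 hy⟩
  have hxv : a • (v : L) = x := congrArg Subtype.val ha
  have hyv : b • (v : L) = y := congrArg Subtype.val hb
  rw [← hxv, ← hyv]
  simp

end ChiralType

end

/-! ### The theorem. -/

open ChiralType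
theorem corollary1 {n m : ℕ} (V : Set (Fin n → ℝ)) (hV : IsOpen V)
    (G : Fin n → Fin n → Fin n → (Fin n → ℝ) → ℝ) (Q : Fin n → (Fin n → ℝ) → ℝ)
    (hG : ∀ α β γ, ContDiffOn ℝ ∞ (G α β γ) V) (hQ : ∀ α, ContDiffOn ℝ ∞ (Q α) V)
    (𝔤 : LieSubalgebra ℝ (Matrix (Fin m) (Fin m) ℂ)) (h𝔤 : IsCompactSemisimple 𝔤)
    (A B : Fin n → (Fin n → ℝ) → 𝔤) (M N : (Fin n → ℝ) → 𝔤) (S : Fin n → (Fin n → ℝ) → 𝔤)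
    (hLax : IsLaxRepresentation V G Q A B M N S)
    (hQ0 : ∃ u ∈ V, ∃ α, Q α u ≠ 0)
    (hdim : n ≤ Module.finrank ℝ 𝔤 ∧ Module.finrank ℝ 𝔤 ≤ n + 1)
    (hS : ∀ u ∈ V, LinearIndependent ℝ (fun α => S α u)) :
    ∃ R : Fin n → (Fin n → ℝ) → ℝ,
      ((R = fun α u => killingForm ℝ 𝔤 (S α u) (M u)) ∨
        (R = fun α u => killingForm ℝ 𝔤 (S α u) (N u))) ∧
      (∀ α, ContDiffOn ℝ ∞ (R α) V) ∧
      (∃ u ∈ V, ∃ α, R α u ≠ 0) ∧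
      IsKillingCovector V G R ∧
      IsClosedTwoForm V (covDeriv G R) ∧
      (∀ u ∈ V, ∑ α, R α u * Q α u = 0) ∧
      ∀ W ⊆ V, IsOpen W → (∃ c ∈ W, StarConvex ℝ c W) →
        ∃ L₁ L₂ : Jet n → ℝ, IsConservationLaw W G Q R L₁ L₂ ∧
          ((∃ u ∈ W, ∃ α, R α u ≠ 0) → ¬ IsTrivialLaw W G Q L₁ L₂) := by
  have : Module.Finite ℝ 𝔤 :=
    inferInstanceAs (Module.Finite ℝ (𝔤 : Submodule ℝ (Matrix (Fin m) (Fin m) ℂ)))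
  let e := (Module.finBasis ℝ 𝔤).equivFun
  have hA := fun α => (hLax.smooth_A α).contDiffOn_coordinates e
  have hB := fun α => (hLax.smooth_B α).contDiffOn_coordinates e
  have hM := hLax.smooth_M.contDiffOn_coordinates e
  have hN := hLax.smooth_N.contDiffOn_coordinates e
  have hSA := fun u (hu : u ∈ V) => hLax.characteristic_eq e hV hu
  have hSs : ∀ α, ContDiffOn ℝ ∞ (fun u => e (S α u)) V := fun α =>
    ((hA α).sub (hB α)).congr fun u hu => hSA u hu α
  have hGS := fun u (hu : u ∈ V) => hLax.connection_eq e hV hu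
  have hMN : ∀ u ∈ V, ⁅M u, N u⁆ = ∑ α, Q α u • S α u := fun u hu => e.injective (by
    rw [← coordBracket_apply, hLax.bracket_eq e hV hu]
    simp)
  have hform : ∀ P : (Fin n → ℝ) → 𝔤, (fun α u => killingForm ℝ 𝔤 (S α u) (P u)) =
      fun α u => coordKilling e (e (S α u)) (e (P u)) := fun P => by
    simp only [coordKilling_apply]
  have hRQ : ∀ P : (Fin n → ℝ) → 𝔤, ∀ u ∈ V,
      ∑ α, killingForm ℝ 𝔤 (S α u) (P u) * Q α u = killingForm ℝ 𝔤 ⁅M u, N u⁆ (P u) := by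
    intro P u hu
    rw [hMN u hu]
    simp [mul_comm]
  have hinv : ∀ x y z : 𝔤, killingForm ℝ 𝔤 ⁅x, y⁆ z = killingForm ℝ 𝔤 x ⁅y, z⁆ :=
    LieModule.traceForm_apply_lie_apply ℝ 𝔤 𝔤
  -- At a point with `Q ≠ 0` the vanishing of both covectors would make `M` and `N` commute, against
  -- `[M, N] = Q^α S_α` with independent `S_α`.
  have hne : (∃ u ∈ V, ∃ α, killingForm ℝ 𝔤 (S α u) (M u) ≠ 0) ∨
      ∃ u ∈ V, ∃ α, killingForm ℝ 𝔤 (S α u) (N u) ≠ 0 := by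
    obtain ⟨u, hu, α, hα⟩ := hQ0
    by_contra! hcon
    have h0 := lie_eq_zero_of_orthogonal h𝔤.2 hdim.2 (hS u hu) (hcon.1 u hu) (hcon.2 u hu)
    rw [hMN u hu] at h0
    exact hα (Fintype.linearIndependent_iff.1 (hS u hu) _ h0 α)
  have hconc : ∀ R : Fin n → (Fin n → ℝ) → ℝ, (∀ α, ContDiffOn ℝ ∞ (R α) V) →
      IsKillingCovector V G R → IsClosedTwoForm V (covDeriv G R) →
      (∀ u ∈ V, ∑ α, R α u * Q α u = 0) →
      ∀ W ⊆ V, IsOpen W → (∃ c ∈ W, StarConvex ℝ c W) →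
        ∃ L₁ L₂ : Jet n → ℝ, IsConservationLaw W G Q R L₁ L₂ ∧
          ((∃ u ∈ W, ∃ α, R α u ≠ 0) → ¬ IsTrivialLaw W G Q L₁ L₂) := by
    intro R hR hK hcl hRQ W hWV hW hstar
    obtain ⟨Ω, hΩ⟩ := exists_isConservationLaw hV hG hR hK hcl hRQ hWV hW hstar
    exact ⟨_, _, hΩ, not_isTrivialLaw hW (fun α β γ => (hG α β γ).mono hWV)
      (fun α => (hQ α).mono hWV)⟩
  rcases hne with hne | hne
  · have hkc := killing_and_closed_left (f := coordKilling e) (coordBracket_skew e)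
      (coordBracket_jacobi e) (coordKilling_invariant e) hV hA hB hSs hM hSA hGS
      (fun u hu => hLax.vderiv_left e hV hu)
    have hR := fun α => contDiffOn_pairing (f := coordKilling e) (hSs α) hM
    rw [← hform M] at hkc
    have hR' : ∀ α, ContDiffOn ℝ ∞ (fun u => killingForm ℝ 𝔤 (S α u) (M u)) V := fun α => by
      simpa only [coordKilling_apply] using hR α
    -- Here `f([M, N], M) = -f([N, M], M) = -f(N, [M, M]) = 0`.
    have hz : ∀ u ∈ V, ∑ α, killingForm ℝ 𝔤 (S α u) (M u) * Q α u = 0 := fun u hu => by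
      rw [hRQ M u hu, ← lie_skew, map_neg, LinearMap.neg_apply, hinv, lie_self, map_zero, neg_zero]
    exact ⟨_, Or.inl rfl, hR', hne, hkc.1, hkc.2, hz, hconc _ hR' hkc.1 hkc.2 hz⟩
  · have hkc := killing_and_closed_right (f := coordKilling e) (coordBracket_skew e)
      (coordBracket_jacobi e) (coordKilling_invariant e) hV hA hB hSs hN hSA hGS
      (fun u hu => hLax.vderiv_right e hV hu)
    have hR := fun α => contDiffOn_pairing (f := coordKilling e) (hSs α) hN
    rw [← hform N] at hkc
    have hR' : ∀ α, ContDiffOn ℝ ∞ (fun u => killingForm ℝ 𝔤 (S α u) (N u)) V := fun α => by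
      simpa only [coordKilling_apply] using hR α
    have hz : ∀ u ∈ V, ∑ α, killingForm ℝ 𝔤 (S α u) (N u) * Q α u = 0 := fun u hu => by
      rw [hRQ N u hu, hinv, lie_self, map_zero]
    exact ⟨_, Or.inr rfl, hR', hne, hkc.1, hkc.2, hz, hconc _ hR' hkc.1 hkc.2 hz⟩
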